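/- Let $g>1$ be an integer and let $\mathbb{G}$ be a finite connected trivalent graph (loops and multiple edges allowed, no open edges) with vertex set $V$ and edge set $E$, whose first Betti number is $g$. For a prime $p$ and $N\ge 1$, let ${}^\dagger C_N$ be the set of triples $(s_1,s_2,s_3)$ of nonnegative integers such that * $s_1+s_2+s_3\le p^N-2$ and $|s_2-s_3|\le s_1\le s_2+s_3$; * for every positive integer $N'<N$ there is a triple $(s_1',s_2',s_3')$ with $s_i'\in\{[s_i]_{N'},\,p^{N'}-1-[s_i]_{N'}\}$ for $i=1,2,3$ (where $[a]_{N'}$ is the remainder of $a$ modulo $p^{N'}$) such that $s_1'+s_2'+s_3'\le p^{N'}-2$ and $|s_2'-s_3'|\le s_1'\le s_2'+s_3'$. Let $\mathrm{Ed}_{p,N,\mathbb{G}}$ be the (finite) set of families $(a_e)_{e\in E}$ of nonnegative integers such that, at each vertex, the numbers on the three edge branches incident to it form a triple in ${}^\dagger C_N$. A quasi-polynomial with coefficients in $\mathbb{Q}$ is a function $H(t)=\sum_i c_i(t)\,t^i$ (finite sum) of an integer variable $t$ whose coefficients $c_i:\mathbb{Z}\to\mathbb{Q}$ are periodic functions;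 its degree is the largest $d$ with $c_d\ne 0$, and $c_d$ is its leading coefficient. For $N\in\{1,2\}$, write $H_N(t)$ for a quasi-polynomial with coefficients in $\mathbb{Q}$, of degree $(3g-3)N$ and of minimum period dividing $4$, such that $\sharp(\mathrm{Ed}_{p,N,\mathbb{G}})=H_N(p)$ for every odd prime $p$. Put $$\lambda_1=\frac{(-1)^g\,B_{2g-2}}{2\cdot(2g-2)!},\qquad \lambda_2=\frac{2^{3g-5}\,B_{2g-2}^2}{((2g-2)!)^2},$$ where $B_{2g-2}$ is the $(2g-2)$-th Bernoulli number ($B_2=\frac16$, $B_4=-\frac1{30}$, $\dots$). Then for each $N\in\{1,2\}$, such an $H_N(t)$ exists with leading coefficient equal to the constant $\lambda_N$. Moreover, for every such $H_N(t)$, the leading coefficient takes the value $\lambda_N$ at every odd integer $t$ (the values at odd primes do not constrain it at even $t$); in particular, if it is constant, it equals $\lambda_N$. -/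

import Mathlib

open scoped Polynomial

/-- A (multi)graph without open edges, with vertex type `V` and edge type `E`. Each edge `e` has
exactly two branches `(e, 0)` and `(e, 1)`, and `ζ` sends a branch to the vertex it is incident to.
Loops and multiple edges are allowed. -/
structure BranchGraph (V E : Type*) where
  ζ : E × Fin 2 → V

namespace BranchGraph

variable {V E : Type*} (G : BranchGraph V E)

/-- The set `B_v` of branches incident to the vertex `v`. -/
def branches (v : V) : Set (E × Fin 2) := {b | G.ζ b = v}

/-- Every vertex has exactly three incident branches. -/
def IsTrivalent : Prop := ∀ v, (G.branches v).ncard = 3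

/-- Two vertices are joined by an edge. -/
def Joined (v w : V) : Prop := ∃ e i j, i ≠ j ∧ G.ζ (e, i) = v ∧ G.ζ (e, j) = w

/-- There is at least one vertex, and any two vertices are linked by a path of edges. -/
def IsConnected : Prop := Nonempty V ∧ ∀ v w, Relation.ReflTransGen G.Joined v w

/-- The cellular boundary map `ℚ^(E) → ℚ^(V)` of the graph, viewed as a one-dimensional
cell complex, each edge being oriented from its branch `0` to its branch `1`. -/
noncomputable def boundary : (E →₀ ℚ) →ₗ[ℚ] (V →₀ ℚ) :=
  Finsupp.linearCombination ℚ fun e =>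
    Finsupp.single (G.ζ (e, 1)) (1 : ℚ) - Finsupp.single (G.ζ (e, 0)) (1 : ℚ)

/-- The first Betti number `dim H₁(G, ℚ)`: there are no two-cells, so `H₁` is the kernel
of the boundary map. -/
noncomputable def bettiOne : ℕ := Module.finrank ℚ (LinearMap.ker G.boundary)

end BranchGraph

/-- The conditions `s₁ + s₂ + s₃ ≤ m - 2` and `|s₂ - s₃| ≤ s₁ ≤ s₂ + s₃`. -/
def IsBalanced (m : ℕ) (s : Fin 3 → ℕ) : Prop :=
  (s 0 : ℤ) + s 1 + s 2 ≤ (m : ℤ) - 2 ∧ |(s 1 : ℤ) - s 2| ≤ s 0 ∧ (s 0 : ℤ) ≤ s 1 + s 2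

/-- The set `†C_N` of triples of nonnegative integers attached to `p` and `N`. The subtraction
below is never truncated for positive `p`, a remainder modulo `p ^ N'` being at most
`p ^ N' - 1`. -/
def daggerC (p N : ℕ) : Set (Fin 3 → ℕ) :=
  {s | IsBalanced (p ^ N) s ∧
    ∀ N', 0 < N' → N' < N → ∃ s' : Fin 3 → ℕ,
      (∀ i, s' i = s i % p ^ N' ∨ s' i = p ^ N' - 1 - s i % p ^ N') ∧ IsBalanced (p ^ N') s'}

/-- The set of balanced `(p, N)`-edge numberings on `G`: for each vertex `v`, the numbers on the
three branches at `v`, listed in any order, form a triple in `†C_N`. -/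
def BranchGraph.Ed {V E : Type*} (G : BranchGraph V E) (p N : ℕ) : Set (E → ℕ) :=
  {a | ∀ v, ∀ b : Fin 3 → E × Fin 2, Function.Injective b → (∀ i, b i ∈ G.branches v) →
    (fun i => a (b i).1) ∈ daggerC p N}

/-- The set of balanced edge numberings is finite, so that `Set.ncard` is its true cardinality. -/
theorem BranchGraph.finite_Ed {V E : Type*} [Finite E] (G : BranchGraph V E)
    (hG : G.IsTrivalent) (p N : ℕ) : (G.Ed p N).Finite := by
  refine (Set.Finite.pi' fun _ : E => Set.finite_Iic (p ^ N)).subset fun a ha e => ?_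
  obtain ⟨x, y, z, hxy, hxz, hyz, hB⟩ := Set.ncard_eq_three.mp (hG (G.ζ (e, 0)))
  have hmem : ((e, 0) : E × Fin 2) ∈ G.branches (G.ζ (e, 0)) := rfl
  have key := (ha (G.ζ (e, 0)) ![x, y, z] (by
    intro i j h
    fin_cases i <;> fin_cases j <;> simp_all [eq_comm]) (by
    intro i
    rw [hB]
    fin_cases i <;> simp)).1.1
  rw [hB] at hmem
  simp only [Matrix.cons_val_zero, Matrix.cons_val_one, Matrix.cons_val] at key
  have hx : x = (e, 0) ∨ y = (e, 0) ∨ z = (e, 0) := by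
    rcases hmem with h | h | h
    · exact Or.inl h.symm
    · exact Or.inr (Or.inl h.symm)
    · exact Or.inr (Or.inr h.symm)
  rw [Set.mem_Iic]
  rcases hx with h | h | h <;> simp only [h] at key <;> omega

/-- A quasi-polynomial with coefficients in `ℚ`, i.e. `t ↦ ∑ i, cᵢ(t) tⁱ` with periodic
coefficient functions `cᵢ : ℤ → ℚ`. It is given by its constituents: `constituent t` is the
polynomial `∑ i, cᵢ(t) Xⁱ`, which depends only on the class of `t` modulo a period. -/
structure QuasiPolynomial where
  constituent : ℤ → ℚ[X]
  exists_period : ∃ m : ℤ, 0 < m ∧ Function.Periodic constituent m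

namespace QuasiPolynomial

/-- The value `∑ i, cᵢ(t) tⁱ`. -/
noncomputable def eval (H : QuasiPolynomial) (t : ℤ) : ℚ := (H.constituent t).eval (t : ℚ)

/-- The coefficient function `cᵢ`. -/
noncomputable def coeff (H : QuasiPolynomial) (i : ℕ) (t : ℤ) : ℚ := (H.constituent t).coeff i

/-- `H` has degree `d`: the function `c_d` is not identically zero, and `cᵢ = 0` for `i > d`. -/
def HasDegree (H : QuasiPolynomial) (d : ℕ) : Prop :=
  (∃ t, H.coeff d t ≠ 0) ∧ ∀ i, d < i → ∀ t, H.coeff i t = 0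

/-- `H` has leading coefficient `x`: its leading coefficient function is constant, equal
to `x`. -/
def HasLeadingCoeff (H : QuasiPolynomial) (x : ℚ) : Prop :=
  ∃ d, H.HasDegree d ∧ ∀ t, H.coeff d t = x

end QuasiPolynomial

/-- `H` is a quasi-polynomial `H_N` attached to the graph `G` of genus `g`: it has degree
`(3g - 3) N`, its minimum period divides `4` (equivalently, `4` is a period), and its value at
every odd prime `p` is the number of balanced `(p, N)`-edge numberings on `G`. -/
structure IsCountingQuasiPolynomial {V E : Type*} (G : BranchGraph V E) (g N : ℕ)
    (H : QuasiPolynomial) : Prop where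
  hasDegree : H.HasDegree ((3 * g - 3) * N)
  periodic : Function.Periodic H.constituent 4
  eval_eq : ∀ p : ℕ, p.Prime → Odd p → H.eval p = ((G.Ed p N).ncard : ℚ)

/-! Balanced triples with bound m are the fusion rules of the integer-spin labels of SU(2) at level
m - 2. The matrix of sines sin((2x+1)π(j+1)/m), with x, j < m/2, diagonalises these rules
(`isBalanced_indicator_eq_sum`). Expanding every vertex of the graph in this basis and summing over
the edge labels forces one common character j on a connected graph (`ncard_balancedNumberings`).
With n = g - 1 there are 3n edges and 2n vertices, so the count is the sum over j of columnNorm^n /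
sin(π(j+1)/m)^(2n).

The full sum of 1/sin^(2n) over 0 < j < m is a polynomial in m of degree at most 2n. Indeed 1/sin² =
4u(1 - u) where u runs through the roots of X^m - (X-1)^m, and Newton's identities apply to these
roots (`exists_polynomial_sum_cyclotomicInv_pow`). Dividing by m^(2n) and letting m grow gives
2ζ(2n)/π^(2n) as top coefficient, hence the Bernoulli number. The count is therefore A(m) for odd m
and B(m) for positive even m, with the same coefficient λ₁ in degree 3n.

For N = 2, a number is split into its residue mod p, folded by r ↦ p - 1 - r, and its doubled
quotient, whose parity records the fold. The condition at p² then splits into independent conditions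
with bounds p and 2p (`isBalanced_sq_iff`), so the count is A(p)B(2p), with top coefficient 2^(3n)
λ₁². Finally, Dirichlet's theorem modulo 4 shows that the values at odd primes determine the
constituents at all odd integers. -/

/-! ### Sine orthogonality and the Verlinde formula -/

open Real Finset in
theorem two_mul_sin_mul_sum_cos_odd (n : ℕ) (γ : ℝ) :
    2 * sin γ * ∑ x ∈ range n, cos ((2 * x + 1) * γ) = sin (2 * n * γ) := by
  induction n with
  | zero => simp
  | succ n ih =>
    rw [sum_range_succ, mul_add, ih]
    have h1 : 2 * ((n + 1 : ℕ) : ℝ) * γ = (2 * n + 1) * γ + γ := by push_cast; ring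
    have h2 : 2 * (n : ℝ) * γ = (2 * n + 1) * γ - γ := by ring
    rw [h1, h2, sin_add, sin_sub]
    ring

/-- The unnormalised entries of the `S`-matrix, for odd labels `2 x + 1` and angles
`π (j + 1) / m`. -/
noncomputable def oddSine (m x j : ℕ) : ℝ :=
  Real.sin ((2 * x + 1) * (Real.pi * (j + 1) / m))

/-- The squared norm of the `j`-th column of `oddSine m`. -/
noncomputable def columnNorm (m j : ℕ) : ℝ :=
  if 2 * (j + 1) = m then (m : ℝ) / 2 else m / 4

theorem columnNorm_pos {m : ℕ} (hm : 0 < m) (j : ℕ) : 0 < columnNorm m j := by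
  unfold columnNorm
  split_ifs <;> positivity

theorem oddSine_zero_pos {m j : ℕ} (hj : j < m / 2) : 0 < oddSine m 0 j := by
  unfold oddSine
  have hm : (0 : ℝ) < m := by exact_mod_cast (by omega : 0 < m)
  have h : ((j : ℝ) + 1) < m := by exact_mod_cast (by omega : j + 1 < m)
  apply Real.sin_pos_of_pos_of_lt_pi
  · have := Real.pi_pos
    simp only [Nat.cast_zero, mul_zero, zero_add, one_mul]
    positivity
  · simp only [Nat.cast_zero, mul_zero, zero_add, one_mul]
    rw [div_lt_iff₀ hm]
    exact mul_lt_mul_of_pos_left h Real.pi_pos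

open Real Finset in
theorem sum_cos_odd_of_even {m : ℕ} (hm : Even m) (hm0 : 0 < m) {l : ℤ} (hl : l ≠ 0)
    (hl1 : |l| < m) : ∑ x ∈ range (m / 2), cos ((2 * x + 1) * (π * l / m)) = 0 := by
  have hmR : (0 : ℝ) < m := by exact_mod_cast hm0
  have key := two_mul_sin_mul_sum_cos_odd (m / 2) (π * l / m)
  have h2 : 2 * ((m / 2 : ℕ) : ℝ) = m := by exact_mod_cast Nat.two_mul_div_two_of_even hm
  rw [h2, show (m : ℝ) * (π * l / m) = l * π by field_simp, sin_int_mul_pi] at key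
  have hs : sin (π * l / m) ≠ 0 := by
    intro h0
    obtain ⟨k, hk⟩ := sin_eq_zero_iff.mp h0
    have : (k : ℝ) * m = l := by
      field_simp at hk
      nlinarith [Real.pi_pos]
    have hkm : k * m = l := by exact_mod_cast this
    have : (m : ℤ) ∣ l := ⟨k, by rw [← hkm]; ring⟩
    exact hl (Int.eq_zero_of_abs_lt_dvd this hl1)
  rcases mul_eq_zero.mp key with h | h
  · exact absurd (by simpa using h) hs
  · exact h

open Real Finset in
theorem sum_cos_odd_of_odd {m : ℕ} (hm : Odd m) {l : ℤ} (hl : l ≠ 0)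
    (hl1 : |l| < m) :
    ∑ x ∈ range (m / 2), cos ((2 * x + 1) * (π * l / m)) = - cos (l * π) / 2 := by
  have hm0 : 0 < m := hm.pos
  have hmR : (0 : ℝ) < m := by exact_mod_cast hm0
  have key := two_mul_sin_mul_sum_cos_odd (m / 2) (π * l / m)
  have h2 : 2 * ((m / 2 : ℕ) : ℝ) = m - 1 := by
    have := Nat.two_mul_div_two_add_one_of_odd hm
    have h : (2 * ((m / 2 : ℕ) : ℝ)) + 1 = m := by exact_mod_cast this
    linarith
  rw [h2, show ((m : ℝ) - 1) * (π * l / m) = l * π - π * l / m by field_simp, sin_sub,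
    sin_int_mul_pi] at key
  have hs : sin (π * l / m) ≠ 0 := by
    intro h0
    obtain ⟨k, hk⟩ := sin_eq_zero_iff.mp h0
    have : (k : ℝ) * m = l := by
      field_simp at hk
      nlinarith [Real.pi_pos]
    have hkm : k * m = l := by exact_mod_cast this
    have : (m : ℤ) ∣ l := ⟨k, by rw [← hkm]; ring⟩
    exact hl (Int.eq_zero_of_abs_lt_dvd this hl1)
  apply mul_left_cancel₀ hs
  linarith

-- The product is half a difference of cosines with frequencies j - j' and j + j' + 2. For even m
-- each nonzero frequency below m sums to 0, and the frequency m, reached only for j = j' = m/2 - 1,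
-- gives -1 in every term and doubles the norm. For odd m the two boundary terms cancel off the
-- diagonal because the frequencies have the same parity.
open Real Finset in
theorem sum_oddSine_mul_oddSine {m j j' : ℕ} (hj : j < m / 2) (hj' : j' < m / 2) :
    ∑ x ∈ range (m / 2), oddSine m x j * oddSine m x j' =
      if j = j' then columnNorm m j else 0 := by
  have hm0 : 0 < m := by omega
  have hmR : (0 : ℝ) < m := by exact_mod_cast hm0
  have hprod : ∀ x : ℕ, oddSine m x j * oddSine m x j' =
      (cos ((2 * x + 1) * (π * ((j - j' : ℤ) : ℝ) / m)) -
        cos ((2 * x + 1) * (π * ((j + j' + 2 : ℤ) : ℝ) / m))) / 2 := by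
    intro x
    have h1 : (2 * x + 1) * (π * ((j - j' : ℤ) : ℝ) / m) =
      (2 * x + 1) * (π * (j + 1) / m) - (2 * x + 1) * (π * (j' + 1) / m) := by
      push_cast; ring
    have h2 : (2 * x + 1) * (π * ((j + j' + 2 : ℤ) : ℝ) / m) =
      (2 * x + 1) * (π * (j + 1) / m) + (2 * x + 1) * (π * (j' + 1) / m) := by
      push_cast; ring
    rw [h1, h2, cos_sub, cos_add]
    unfold oddSine
    ring
  simp_rw [hprod]
  rw [← sum_div, sum_sub_distrib]
  have hplus : (j + j' + 2 : ℤ) ≠ 0 := by omega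
  rcases Nat.even_or_odd m with hm | hm
  · have h2 : ((m / 2 : ℕ) : ℝ) = m / 2 := by
      have : 2 * ((m / 2 : ℕ) : ℝ) = m := by exact_mod_cast Nat.two_mul_div_two_of_even hm
      linarith
    split_ifs with h
    · subst h
      simp only [sub_self, Int.cast_zero, mul_zero, zero_div, cos_zero, sum_const, card_range,
        nsmul_eq_mul, mul_one, h2]
      unfold columnNorm
      split_ifs with h3
      · have hcos : ∀ x : ℕ, cos ((2 * x + 1) * (π * ((j + j + 2 : ℤ) : ℝ) / m)) = -1 := by
          intro x
          have : (π * ((j + j + 2 : ℤ) : ℝ) / m) = π := by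
            have : ((j + j + 2 : ℤ) : ℝ) = m := by
              exact_mod_cast (by omega : (j + j + 2 : ℤ) = m)
            rw [this]; field_simp
          rw [this, show (2 * (x : ℝ) + 1) * π = π + x * (2 * π) by ring, cos_add_nat_mul_two_pi,
            cos_pi]
        simp only [hcos, sum_const, card_range, nsmul_eq_mul, h2]
        ring
      · rw [sum_cos_odd_of_even hm hm0 hplus (by rw [abs_of_nonneg] <;> omega)]
        ring
    · rw [sum_cos_odd_of_even hm hm0 (by omega) (by rw [abs_lt]; omega)]
      by_cases h3 : j + j' + 2 = m
      · omega
      · rw [sum_cos_odd_of_even hm hm0 hplus (by rw [abs_of_nonneg] <;> omega)]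
        simp
  · have h2 : ((m / 2 : ℕ) : ℝ) = (m - 1) / 2 := by
      have : 2 * ((m / 2 : ℕ) : ℝ) + 1 = m := by
        exact_mod_cast Nat.two_mul_div_two_add_one_of_odd hm
      linarith
    have hm1 := Nat.odd_iff.mp hm
    rw [sum_cos_odd_of_odd hm hplus (by rw [abs_of_nonneg] <;> omega)]
    split_ifs with h
    · subst h
      simp only [sub_self, Int.cast_zero, mul_zero, zero_div, cos_zero, sum_const, card_range,
        nsmul_eq_mul, mul_one, h2]
      have : ((j + j + 2 : ℤ) : ℝ) * π = ((j + 1 : ℕ) : ℝ) * (2 * π) := by push_cast; ring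
      rw [this, cos_nat_mul_two_pi, columnNorm, if_neg (by omega)]
      ring
    · rw [sum_cos_odd_of_odd hm (by omega) (by rw [abs_lt]; omega)]
      have : ((j + j' + 2 : ℤ) : ℝ) * π = ((j - j' : ℤ) : ℝ) * π + ((j' + 1 : ℕ) : ℝ) * (2 * π) := by
        push_cast; ring
      rw [this, cos_add_nat_mul_two_pi]
      simp

-- Dual orthogonality: labels and characters are equally many, so the one-sided inverse given by the
-- column relations is two-sided.
open Finset in
theorem sum_oddSine_mul_oddSine_div {m x y : ℕ} (hx : x < m / 2) (hy : y < m / 2) :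
    ∑ j ∈ range (m / 2), oddSine m x j * oddSine m y j / columnNorm m j =
      if x = y then 1 else 0 := by
  have hm0 : 0 < m := by omega
  let A : Matrix (Fin (m / 2)) (Fin (m / 2)) ℝ :=
    Matrix.of fun j x => oddSine m x j / columnNorm m j
  let B : Matrix (Fin (m / 2)) (Fin (m / 2)) ℝ := Matrix.of fun x j => oddSine m x j
  have hAB : A * B = 1 := by
    ext j j'
    have key := sum_oddSine_mul_oddSine j.2 j'.2
    rw [← Fin.sum_univ_eq_sum_range (fun x => oddSine m x j * oddSine m x j')] at key
    simp only [Matrix.mul_apply, A, B, Matrix.one_apply, Matrix.of_apply, div_mul_eq_mul_div]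
    rw [← sum_div, key]
    split_ifs with h1 h2 h2
    · exact div_self (columnNorm_pos hm0 _).ne'
    · exact absurd (Fin.ext h1) h2
    · exact absurd (congrArg Fin.val h2) h1
    · simp
  have hBA : (B * A) ⟨x, hx⟩ ⟨y, hy⟩ = (1 : Matrix (Fin (m / 2)) (Fin (m / 2)) ℝ) ⟨x, hx⟩ ⟨y, hy⟩ := by
    rw [mul_eq_one_comm.mp hAB]
  rw [← Fin.sum_univ_eq_sum_range (fun j => oddSine m x j * oddSine m y j / columnNorm m j)]
  simp only [Matrix.mul_apply, A, B, Matrix.one_apply, Matrix.of_apply, Fin.mk.injEq] at hBA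
  rw [← hBA]
  exact sum_congr rfl fun j _ => by ring

open Finset Real in
theorem sum_Ico_sin_odd (θ : ℝ) {l k : ℕ} (h : l ≤ k) :
    2 * sin θ * ∑ c ∈ Ico l k, sin ((2 * c + 1) * θ) = cos (2 * l * θ) - cos (2 * k * θ) := by
  induction k, h using Nat.le_induction with
  | base => simp
  | succ k hk ih =>
    rw [sum_Ico_succ_top hk, mul_add, ih]
    have h1 : 2 * ((k + 1 : ℕ) : ℝ) * θ = (2 * k + 1) * θ + θ := by push_cast; ring
    have h2 : 2 * (k : ℝ) * θ = (2 * k + 1) * θ - θ := by ring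
    rw [h1, h2, cos_add, cos_sub]
    ring

-- For fixed a and b the admissible c form an interval, over which the sines telescope to a
-- difference of two cosines, that is, to a product of two sines.
open Finset Real Classical in
theorem sum_isBalanced_oddSine {m a b j : ℕ} (ha : a < m / 2) (hb : b < m / 2) (hj : j < m / 2) :
    ∑ c ∈ range (m / 2), (if IsBalanced m ![a, b, c] then oddSine m c j else 0) =
      oddSine m a j * oddSine m b j / oddSine m 0 j := by
  have hmR : (m : ℝ) ≠ 0 := by exact_mod_cast (by omega : m ≠ 0)
  rw [eq_div_iff (oddSine_zero_pos hj).ne', ← sum_filter]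
  -- With truncated subtraction the lower end is |a - b|. The difference m - 2 - (a + b) is not
  -- truncated, since a, b < m/2.
  have hset : (range (m / 2)).filter (fun c => IsBalanced m ![a, b, c]) =
      Ico ((a - b) + (b - a)) (min (a + b) (m - 2 - (a + b)) + 1) := by
    ext c
    simp only [mem_filter, mem_range, IsBalanced, Matrix.cons_val_zero, Matrix.cons_val_one,
      Matrix.cons_val, mem_Ico, abs_le]
    constructor
    · intro h
      omega
    · intro h
      by_cases h1 : a + b ≤ m - 2 <;> omega
  rw [hset]
  have key := sum_Ico_sin_odd (π * (j + 1) / m)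
    (show (a - b) + (b - a) ≤ min (a + b) (m - 2 - (a + b)) + 1 by omega)
  have hlo : cos (2 * (((a - b) + (b - a) : ℕ) : ℝ) * (π * (j + 1) / m)) =
      cos (2 * ((a : ℝ) - b) * (π * (j + 1) / m)) := by
    rcases le_total a b with h | h
    · rw [Nat.sub_eq_zero_of_le h, zero_add, Nat.cast_sub h, ← cos_neg]
      congr 1; ring
    · rw [Nat.sub_eq_zero_of_le h, add_zero, Nat.cast_sub h]
  -- Both candidates for the upper end give the same cosine: K ↦ m - K changes the angle 2Kπ(j+1)/m
  -- only by its sign and a multiple of 2π.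
  have hhi : cos (2 * ((min (a + b) (m - 2 - (a + b)) + 1 : ℕ) : ℝ) * (π * (j + 1) / m)) =
      cos (2 * ((a : ℝ) + b + 1) * (π * (j + 1) / m)) := by
    rcases le_total (a + b) (m - 2 - (a + b)) with h | h
    · rw [min_eq_left h]; push_cast; rfl
    · rw [min_eq_right h]
      have : m - 2 - (a + b) + 1 = m - (a + b + 1) := by omega
      rw [this, Nat.cast_sub (by omega), ← cos_neg,
        ← cos_add_nat_mul_two_pi _ (j + 1)]
      congr 1
      push_cast
      field_simp
      ring
  rw [hlo, hhi] at key
  have h1 : 2 * ((a : ℝ) - b) * (π * (j + 1) / m) =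
    (2 * a + 1) * (π * (j + 1) / m) - (2 * b + 1) * (π * (j + 1) / m) := by ring
  have h2 : 2 * ((a : ℝ) + b + 1) * (π * (j + 1) / m) =
    (2 * a + 1) * (π * (j + 1) / m) + (2 * b + 1) * (π * (j + 1) / m) := by ring
  rw [h1, h2, cos_sub, cos_add] at key
  have h0 : oddSine m 0 j = sin (π * (j + 1) / m) := by simp [oddSine]
  rw [h0]
  simp only [oddSine]
  linarith

open Finset Classical in
/-- The Verlinde formula for the fusion rule of the labels `x < m / 2`. -/
theorem isBalanced_indicator_eq_sum {m a b c : ℕ} (ha : a < m / 2) (hb : b < m / 2)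
    (hc : c < m / 2) :
    (if IsBalanced m ![a, b, c] then (1 : ℝ) else 0) =
      ∑ j ∈ range (m / 2), (columnNorm m j * oddSine m 0 j)⁻¹ *
        (oddSine m a j * oddSine m b j * oddSine m c j) := by
  -- The quotient of the sines of a and b by that of 0 unfolds into a sum over fused labels d; dual
  -- orthogonality in j then selects d = c.
  have : ∀ j ∈ range (m / 2), (columnNorm m j * oddSine m 0 j)⁻¹ *
        (oddSine m a j * oddSine m b j * oddSine m c j) =
      ∑ d ∈ range (m / 2), (if IsBalanced m ![a, b, d] then 1 else 0) *
        (oddSine m d j * oddSine m c j / columnNorm m j) := by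
    intro j hj
    have h := sum_isBalanced_oddSine ha hb (mem_range.mp hj)
    calc _ = (oddSine m a j * oddSine m b j / oddSine m 0 j) *
          (oddSine m c j / columnNorm m j) := by rw [mul_inv]; ring
      _ = _ := by
        rw [← h, sum_mul]
        refine sum_congr rfl fun d _ => ?_
        split_ifs <;> ring
  rw [sum_congr rfl this, sum_comm]
  simp_rw [← mul_sum]
  rw [sum_congr rfl fun d hd => by rw [sum_oddSine_mul_oddSine_div (mem_range.mp hd) hc]]
  simp [hc]

/-! ### Balanced edge numberings and their character sum -/

theorem IsBalanced.lt_half {m : ℕ} {s : Fin 3 → ℕ} (h : IsBalanced m s) (i : Fin 3) :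
    s i < m / 2 := by
  obtain ⟨h1, h2, h3⟩ := h
  rw [abs_le] at h2
  fin_cases i <;> simp only [Fin.zero_eta, Fin.mk_one, Fin.reduceFinMk] <;> omega

/-- In this form the condition is visibly symmetric, so the order in which the branches at a vertex
are listed is irrelevant. -/
theorem isBalanced_iff_sum {m : ℕ} {s : Fin 3 → ℕ} :
    IsBalanced m s ↔ ∑ i, s i + 2 ≤ m ∧ ∀ i, 2 * s i ≤ ∑ i, s i := by
  simp only [IsBalanced, Fin.sum_univ_three, Fin.forall_fin_succ, abs_le]
  simp
  omega

theorem IsBalanced.comp_injective {m : ℕ} {s : Fin 3 → ℕ} (h : IsBalanced m s)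
    {σ : Fin 3 → Fin 3} (hσ : Function.Injective σ) : IsBalanced m (s ∘ σ) := by
  rw [isBalanced_iff_sum] at h ⊢
  have : ∑ i, (s ∘ σ) i = ∑ i, s i :=
    (Equiv.ofBijective σ (Finite.injective_iff_bijective.mp hσ)).sum_comp s
  rw [this]
  exact ⟨h.1, fun i => h.2 (σ i)⟩

namespace BranchGraph

variable {V E : Type*} (G : BranchGraph V E)

/-- The edge numberings that are balanced with bound `m` at every vertex. -/
def balancedNumberings (m : ℕ) : Set (E → ℕ) :=
  {a | ∀ v, ∀ b : Fin 3 → E × Fin 2, Function.Injective b → (∀ i, b i ∈ G.branches v) →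
    IsBalanced m (fun i => a (b i).1)}

theorem Ed_one (p : ℕ) : G.Ed p 1 = G.balancedNumberings p := by
  ext a
  simp only [Ed, daggerC, balancedNumberings, Set.mem_ofPred_eq, pow_one]
  refine forall_congr' fun v => forall_congr' fun b => forall_congr' fun _ =>
    forall_congr' fun _ => ⟨fun h => h.1, fun h => ⟨h, fun N' h1 h2 => by omega⟩⟩

variable {G}

theorem IsTrivalent.exists_equiv (htri : G.IsTrivalent) (v : V) :
    Nonempty (Fin 3 ≃ G.branches v) := by
  have h := htri v
  have hfin : (G.branches v).Finite := Set.finite_of_ncard_ne_zero (by omega)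
  have := hfin.to_subtype
  exact ⟨(finCongr (by rw [← h]; rfl)).trans (Finite.equivFin (G.branches v)).symm⟩

theorem mem_balancedNumberings_iff (β : ∀ v, Fin 3 ≃ G.branches v) {m : ℕ} {a : E → ℕ} :
    a ∈ G.balancedNumberings m ↔ ∀ v, IsBalanced m (fun i => a (β v i).1.1) := by
  constructor
  · intro h v
    exact h v (fun i => (β v i).1) (Subtype.val_injective.comp (β v).injective)
      (fun i => (β v i).2)
  · intro h v b hb hbv
    have h1 := (h v).comp_injective (σ := fun i => (β v).symm ⟨b i, hbv i⟩)
      (fun i j hij => hb (by simpa using hij))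
    convert h1 using 1
    funext i
    simp

theorem exists_branch (htri : G.IsTrivalent) (e : E) :
    ∃ v, ∃ b : Fin 3 → E × Fin 2, Function.Injective b ∧ (∀ i, b i ∈ G.branches v) ∧
      ∃ i, (b i).1 = e := by
  obtain ⟨β⟩ := htri.exists_equiv (G.ζ (e, 0))
  refine ⟨_, fun i => (β i).1, Subtype.val_injective.comp β.injective, fun i => (β i).2,
    β.symm ⟨(e, 0), rfl⟩, by simp⟩

theorem balancedNumberings_lt_half (htri : G.IsTrivalent) {m : ℕ} {a : E → ℕ}
    (ha : a ∈ G.balancedNumberings m) (e : E) : a e < m / 2 := by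
  obtain ⟨v, b, hb, hbv, i, rfl⟩ := exists_branch htri e
  exact (ha v b hb hbv).lt_half i

/-- A product over all branches, grouped by vertices or by edges. -/
theorem prod_branches {M : Type*} [CommMonoid M] [Fintype V] [Fintype E]
    (β : ∀ v, Fin 3 ≃ G.branches v) (f : E × Fin 2 → M) :
    ∏ v, ∏ i, f (β v i).1 = ∏ e, (f (e, 0) * f (e, 1)) := by
  have h1 : ∏ v, ∏ i, f (β v i).1 =
      ∏ x : Σ _ : V, Fin 3, f (((Equiv.sigmaCongrRight β).trans (Equiv.sigmaFiberEquiv G.ζ)) x) := by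
    rw [← Finset.univ_sigma_univ, Finset.prod_sigma]
    rfl
  rw [h1, Equiv.prod_comp _ f, Fintype.prod_prod_type]
  simp

theorem three_mul_card [Fintype V] [Fintype E] (htri : G.IsTrivalent) :
    3 * Fintype.card V = 2 * Fintype.card E := by
  have β := fun v => (htri.exists_equiv v).some
  -- The constant 2 turns the regrouping into an equality of powers of 2, whose exponents count the
  -- branches by vertices and by edges.
  have h := prod_branches β (fun _ => 2)
  simp only [Finset.prod_const, Finset.card_univ, Fintype.card_fin, ← pow_two, ← pow_mul] at h
  exact Nat.pow_right_injective le_rfl h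

theorem IsConnected.eq_of_forall_edge {α : Type*} (hconn : G.IsConnected) {J : V → α}
    (h : ∀ e, J (G.ζ (e, 0)) = J (G.ζ (e, 1))) (v w : V) : J v = J w := by
  induction hconn.2 v w with
  | refl => rfl
  | tail _ hj ih =>
    obtain ⟨e, i, j, hij, rfl, rfl⟩ := hj
    rw [ih]
    fin_cases i <;> fin_cases j <;> simp at hij ⊢
    · exact h e
    · exact (h e).symm

open Finset Classical in
/-- The number of balanced numberings as a sum over characters. -/
theorem ncard_balancedNumberings [Fintype V] [Fintype E] (hconn : G.IsConnected)
    (htri : G.IsTrivalent) (m : ℕ) :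
    ((G.balancedNumberings m).ncard : ℝ) =
      ∑ j ∈ range (m / 2), columnNorm m j ^ Fintype.card E *
        ((columnNorm m j * oddSine m 0 j)⁻¹) ^ Fintype.card V := by
  have β := fun v => (htri.exists_equiv v).some
  set n := m / 2 with hn
  have hset : G.balancedNumberings m =
      ↑((Fintype.piFinset fun _ : E => range n).filter
        fun a => ∀ v, IsBalanced m (fun i => a (β v i).1.1)) := by
    ext a
    rw [mem_coe, mem_filter, Fintype.mem_piFinset, ← mem_balancedNumberings_iff β]
    exact ⟨fun h => ⟨fun e => mem_range.mpr (balancedNumberings_lt_half htri h e), h⟩,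
      fun h => h.2⟩
  rw [hset, Set.ncard_coe_finset, card_filter, Nat.cast_sum]
  -- Each vertex indicator is expanded by the Verlinde formula; J chooses one character per vertex,
  -- and the sine factors are regrouped by edges.
  have hterm : ∀ a ∈ Fintype.piFinset fun _ : E => range n,
      (((if ∀ v, IsBalanced m (fun i => a (β v i).1.1) then 1 else 0 : ℕ)) : ℝ) =
      ∑ J ∈ Fintype.piFinset fun _ : V => range n,
        (∏ v, (columnNorm m (J v) * oddSine m 0 (J v))⁻¹) *
          ∏ e, (oddSine m (a e) (J (G.ζ (e, 0))) * oddSine m (a e) (J (G.ζ (e, 1)))) := by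
    intro a ha
    rw [Fintype.mem_piFinset] at ha
    have h1 : (((if ∀ v, IsBalanced m (fun i => a (β v i).1.1) then 1 else 0 : ℕ)) : ℝ) =
        ∏ v, (if IsBalanced m (fun i => a (β v i).1.1) then (1 : ℝ) else 0) := by
      rw [Fintype.prod_boole]
      push_cast
      rfl
    rw [h1]
    have h2 : ∀ v, (if IsBalanced m (fun i => a (β v i).1.1) then (1 : ℝ) else 0) =
        ∑ j ∈ range n, (columnNorm m j * oddSine m 0 j)⁻¹ *
          ∏ i, oddSine m (a (β v i).1.1) j := by
      intro v
      have hlt := fun i => mem_range.mp (ha (β v i).1.1)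
      have := isBalanced_indicator_eq_sum (hlt 0) (hlt 1) (hlt 2)
      simp only [Fin.prod_univ_three]
      rw [← this]
      congr 2
      funext i
      fin_cases i <;> rfl
    rw [prod_congr rfl fun v _ => h2 v, prod_univ_sum]
    refine sum_congr rfl fun J _ => ?_
    rw [prod_mul_distrib]
    congr 1
    rw [← prod_branches β (fun b => oddSine m (a b.1) (J (G.ζ b)))]
    refine prod_congr rfl fun v _ => prod_congr rfl fun i _ => ?_
    rw [show G.ζ (β v i).1 = v from (β v i).2]
  rw [sum_congr rfl hterm, sum_comm]
  -- For fixed J the sum over numberings factors over the edges, and orthogonality makes J agree at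
  -- the two ends of each edge.
  have hJ : ∀ J ∈ Fintype.piFinset fun _ : V => range n,
      ∑ a ∈ Fintype.piFinset fun _ : E => range n,
        (∏ v, (columnNorm m (J v) * oddSine m 0 (J v))⁻¹) *
          ∏ e, (oddSine m (a e) (J (G.ζ (e, 0))) * oddSine m (a e) (J (G.ζ (e, 1)))) =
      (∏ v, (columnNorm m (J v) * oddSine m 0 (J v))⁻¹) *
        ∏ e, if J (G.ζ (e, 0)) = J (G.ζ (e, 1)) then columnNorm m (J (G.ζ (e, 0))) else 0 := by
    intro J hJ
    rw [Fintype.mem_piFinset] at hJ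
    rw [← mul_sum, ← prod_univ_sum (fun _ : E => range n) fun e x =>
      oddSine m x (J (G.ζ (e, 0))) * oddSine m x (J (G.ζ (e, 1)))]
    congr 1
    exact prod_congr rfl fun e _ =>
      sum_oddSine_mul_oddSine (mem_range.mp (hJ _)) (mem_range.mp (hJ _))
  rw [sum_congr rfl hJ]
  obtain ⟨v0⟩ := hconn.1
  have hinj : Set.InjOn (fun j : ℕ => (fun _ : V => j)) (range n : Set ℕ) :=
    fun j _ k _ h => congrFun h v0
  symm
  have himg : ∀ j ∈ range n, columnNorm m j ^ Fintype.card E *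
        ((columnNorm m j * oddSine m 0 j)⁻¹) ^ Fintype.card V =
      (fun J : V → ℕ => (∏ v, (columnNorm m (J v) * oddSine m 0 (J v))⁻¹) *
        ∏ e, if J (G.ζ (e, 0)) = J (G.ζ (e, 1)) then columnNorm m (J (G.ζ (e, 0))) else 0)
        (fun _ => j) := by
    intro j _
    simp [Finset.prod_const, Finset.card_univ, mul_comm]
  rw [sum_congr rfl himg, ← sum_image (f := fun J : V → ℕ =>
    (∏ v, (columnNorm m (J v) * oddSine m 0 (J v))⁻¹) *
        ∏ e, if J (G.ζ (e, 0)) = J (G.ζ (e, 1)) then columnNorm m (J (G.ζ (e, 0))) else 0) hinj]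
  -- By connectedness a nonconstant J differs across some edge, so its term vanishes.
  refine sum_subset ?_ ?_
  · intro J hJ'
    obtain ⟨j, hj, rfl⟩ := mem_image.mp hJ'
    simpa using fun _ => mem_range.mp hj
  · intro J hJ' hnot
    have : ∃ e, J (G.ζ (e, 0)) ≠ J (G.ζ (e, 1)) := by
      by_contra! hall
      refine hnot (mem_image.mpr ⟨J v0, (Fintype.mem_piFinset.mp hJ') v0, ?_⟩)
      funext v
      exact hconn.eq_of_forall_edge hall v0 v
    obtain ⟨e, he⟩ := this
    rw [prod_eq_zero (mem_univ e) (if_neg he), mul_zero]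

/-! ### First Betti number and numbers of vertices and edges -/

/-- The range of the boundary map of a connected graph is the augmentation kernel. -/
theorem IsConnected.range_boundary (hconn : G.IsConnected) :
    LinearMap.range G.boundary =
      LinearMap.ker (Finsupp.linearCombination ℚ fun _ : V => (1 : ℚ)) := by
  apply le_antisymm
  · rw [LinearMap.range_le_ker_iff]
    ext e
    simp [boundary]
  · have hedge : ∀ v w, Finsupp.single w (1 : ℚ) - Finsupp.single v 1 ∈
        LinearMap.range G.boundary := by
      intro v w
      induction hconn.2 v w with
      | refl => simp
      | tail _ hj ih =>
        rename_i b c _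
        have : Finsupp.single c (1 : ℚ) - Finsupp.single b 1 ∈ LinearMap.range G.boundary := by
          obtain ⟨e, i, j, hij, rfl, rfl⟩ := hj
          have he : Finsupp.single (G.ζ (e, 1)) (1 : ℚ) - Finsupp.single (G.ζ (e, 0)) 1 ∈
              LinearMap.range G.boundary := ⟨Finsupp.single e 1, by simp [boundary]⟩
          fin_cases i <;> fin_cases j <;> simp at hij ⊢
          · simpa using he
          · simpa using neg_mem he
        simpa using add_mem this ih
    obtain ⟨v0⟩ := hconn.1
    intro x hx
    have hx0 : x.sum (fun _ c => c) = 0 := by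
      simpa [Finsupp.linearCombination_apply] using hx
    have : x = x.sum fun v c => c • (Finsupp.single v (1 : ℚ) - Finsupp.single v0 1) := by
      simp only [smul_sub, Finsupp.smul_single, smul_eq_mul, mul_one]
      rw [Finsupp.sum_sub, Finsupp.sum_single]
      have : (x.sum fun _ c => Finsupp.single v0 c) = 0 := by
        rw [Finsupp.sum, ← Finsupp.single_finsetSum]
        rw [Finsupp.sum] at hx0
        simp [hx0]
      rw [this, sub_zero]
    rw [this]
    exact Submodule.sum_mem _ fun v _ => Submodule.smul_mem _ _ (hedge v0 v)

/-- Rank-nullity is applied to the boundary map and to the augmentation, whose kernel is the image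
of the former. -/
theorem IsConnected.bettiOne_add_card [Fintype V] [Fintype E] (hconn : G.IsConnected) :
    G.bettiOne + Fintype.card V = Fintype.card E + 1 := by
  have h1 := LinearMap.finrank_range_add_finrank_ker G.boundary
  have h2 := LinearMap.finrank_range_add_finrank_ker
    (Finsupp.linearCombination ℚ fun _ : V => (1 : ℚ))
  obtain ⟨v0⟩ := hconn.1
  have hsurj : LinearMap.range (Finsupp.linearCombination ℚ fun _ : V => (1 : ℚ)) = ⊤ := by
    rw [LinearMap.range_eq_top]
    intro c
    exact ⟨Finsupp.single v0 c, by simp⟩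
  rw [hsurj, finrank_top, ← hconn.range_boundary] at h2
  simp only [Module.finrank_self, Module.finrank_finsupp_self] at h1 h2
  unfold bettiOne
  omega

theorem card_vertices_edges [Fintype V] [Fintype E] (hconn : G.IsConnected)
    (htri : G.IsTrivalent) {g : ℕ} (hgenus : G.bettiOne = g) :
    Fintype.card V = 2 * (g - 1) ∧ Fintype.card E = 3 * (g - 1) := by
  have h1 := three_mul_card htri
  have h2 := hconn.bettiOne_add_card
  omega

end BranchGraph

/-! ### Power sums of 1/sin² as polynomials in m -/

/-- The roots `1 / (1 - ω)` of `X ^ m - (X - 1) ^ m`, for the `m`-th roots of unity `ω ≠ 1`. -/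
noncomputable def cyclotomicInv (m j : ℕ) : ℂ :=
  (1 - Complex.exp (2 * Real.pi * Complex.I / m) ^ (j + 1))⁻¹

theorem one_sub_exp_pow_ne_zero {m j : ℕ} (hj : j + 1 < m) :
    1 - Complex.exp (2 * Real.pi * Complex.I / m) ^ (j + 1) ≠ 0 := by
  have h := (Complex.isPrimitiveRoot_exp m (by omega)).pow_ne_one_of_pos_of_lt
    (Nat.succ_ne_zero j) hj
  exact sub_ne_zero.mpr h.symm

/-- For u = 1/(1 - ω) one has u(1 - u) = -ω/(1 - ω)², and ω = z² with z = exp(iθ) gives 1 - ω = -2i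
z sin θ. -/
theorem four_mul_cyclotomicInv {m j : ℕ} (hj : j + 1 < m) :
    4 * (cyclotomicInv m j * (1 - cyclotomicInv m j)) =
      ((1 / Real.sin (Real.pi * (j + 1) / m) ^ 2 : ℝ) : ℂ) := by
  have h := one_sub_exp_pow_ne_zero hj
  set θ : ℂ := Real.pi * (j + 1) / m with hθ
  have hz : Complex.exp (2 * Real.pi * Complex.I / m) ^ (j + 1) =
      Complex.exp (θ * Complex.I) ^ 2 := by
    rw [← Complex.exp_nat_mul, ← Complex.exp_nat_mul]
    congr 1
    push_cast
    rw [hθ]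
    ring
  have hm : (m : ℂ) ≠ 0 := by exact_mod_cast (by omega : m ≠ 0)
  unfold cyclotomicInv
  rw [hz] at h ⊢
  push_cast
  rw [← hθ, Complex.sin, neg_mul, Complex.exp_neg]
  have hz0 := Complex.exp_ne_zero (θ * Complex.I)
  set z := Complex.exp (θ * Complex.I)
  have hI : Complex.I ^ 2 = -1 := Complex.I_sq
  have h' : z⁻¹ - z ≠ 0 := by
    intro h0
    apply h
    field_simp at h0
    linear_combination h0
  have hsq : ((z⁻¹ - z) * Complex.I / 2) ^ 2 = - (1 - z ^ 2) ^ 2 / (4 * z ^ 2) := by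
    rw [div_pow, mul_pow, hI]
    field_simp
    ring
  rw [hsq]
  field_simp
  ring

open Polynomial in
theorem coeff_X_pow_sub_X_sub_one_pow {m k : ℕ} (hk : k < m) :
    ((X : ℂ[X]) ^ m - (X + C (-1)) ^ m).coeff (m - 1 - k) = (-1) ^ k * (m.choose (k + 1) : ℂ) := by
  rw [coeff_sub, coeff_X_pow, coeff_X_add_C_pow, if_neg (by omega)]
  have h1 : m - (m - 1 - k) = k + 1 := by omega
  have h2 : m.choose (m - 1 - k) = m.choose (k + 1) := by
    rw [← Nat.choose_symm (by omega : k + 1 ≤ m)]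
    congr 1
    omega
  rw [h1, h2, pow_succ]
  ring

open Polynomial in
theorem natDegree_X_pow_sub_X_sub_one_pow {m : ℕ} (hm : 0 < m) :
    ((X : ℂ[X]) ^ m - (X + C (-1)) ^ m).natDegree = m - 1 := by
  apply natDegree_eq_of_le_of_coeff_ne_zero
  · rw [natDegree_le_iff_coeff_eq_zero]
    intro i hi
    rw [coeff_sub, coeff_X_pow, coeff_X_add_C_pow]
    rcases eq_or_lt_of_le (show m ≤ i by omega) with h | h
    · subst h
      simp
    · rw [if_neg (by omega), Nat.choose_eq_zero_of_lt h]
      simp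
  · have := coeff_X_pow_sub_X_sub_one_pow (k := 0) hm
    simp only [Nat.sub_zero] at this
    rw [this]
    simp
    omega

-- Vieta's formulas for X^m - (X-1)^m, of degree m - 1 and leading coefficient m. For k ≥ m both
-- sides vanish.
open Polynomial in
theorem esymm_cyclotomicInv {m : ℕ} (hm : 0 < m) (k : ℕ) :
    (m : ℂ) * MvPolynomial.aeval (fun j : Fin (m - 1) => cyclotomicInv m j)
      (MvPolynomial.esymm (Fin (m - 1)) ℚ k) = (m.choose (k + 1) : ℂ) := by
  have hω := Complex.isPrimitiveRoot_exp m (by omega)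
  set p : ℂ[X] := X ^ m - (X + C (-1)) ^ m with hp
  have hdeg : p.natDegree = m - 1 := natDegree_X_pow_sub_X_sub_one_pow hm
  have hlead : p.leadingCoeff = m := by
    rw [leadingCoeff, hdeg]
    have h := coeff_X_pow_sub_X_sub_one_pow (k := 0) hm
    rw [Nat.sub_zero, ← hp] at h
    rw [h]
    simp
  have hp0 : p ≠ 0 := by
    rw [← leadingCoeff_ne_zero, hlead]
    exact_mod_cast hm.ne'
  have hinj : Function.Injective (fun j : Fin (m - 1) => cyclotomicInv m j) := by
    intro i j hij
    have h1 : Complex.exp (2 * Real.pi * Complex.I / m) ^ ((i : ℕ) + 1) =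
        Complex.exp (2 * Real.pi * Complex.I / m) ^ ((j : ℕ) + 1) := by
      have := inv_injective hij
      linear_combination -this
    have := hω.pow_inj (by omega) (by omega) h1
    exact Fin.ext (by omega)
  have hroots : (Finset.univ.val.map (fun j : Fin (m - 1) => cyclotomicInv m j)) = p.roots := by
    apply Multiset.eq_of_le_of_card_le
    · rw [Multiset.le_iff_subset (Finset.univ.nodup.map hinj)]
      intro x hx
      obtain ⟨j, -, rfl⟩ := Multiset.mem_map.mp hx
      rw [mem_roots hp0, IsRoot.def]
      have hne := one_sub_exp_pow_ne_zero (show (j : ℕ) + 1 < m by omega)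
      have h1 : cyclotomicInv m j - 1 =
          Complex.exp (2 * Real.pi * Complex.I / m) ^ ((j : ℕ) + 1) * cyclotomicInv m j := by
        unfold cyclotomicInv
        field_simp
        ring
      simp only [hp, eval_sub, eval_pow, eval_add, eval_X, eval_C, ← sub_eq_add_neg]
      rw [h1, mul_pow, ← pow_mul, mul_comm _ m, pow_mul, hω.pow_eq_one]
      simp
    · refine (card_roots' p).trans ?_
      simp [hdeg]
  rw [MvPolynomial.aeval_esymm_eq_multiset_esymm, hroots]
  rcases lt_or_ge k m with hk | hk
  · have hcard : Multiset.card p.roots = p.natDegree := by rw [← hroots]; simp [hdeg]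
    have h := coeff_eq_esymm_roots_of_card hcard (k := m - 1 - k) (by omega)
    rw [coeff_X_pow_sub_X_sub_one_pow hk, hdeg, hlead,
      show m - 1 - (m - 1 - k) = k by omega] at h
    have hs : ((-1 : ℂ) ^ k) ≠ 0 := by simp
    apply mul_left_cancel₀ hs
    linear_combination -h
  · rw [Nat.choose_eq_zero_of_lt (by omega), Multiset.esymm,
      Multiset.powersetCard_eq_empty _ (by rw [← hroots]; simp; omega)]
    simp

-- The quotient is (m-1)(m-2)⋯(m-k)/(k+1)!, of degree k in m.
open Polynomial in
theorem exists_polynomial_choose_div (k : ℕ) : ∃ P : ℚ[X], P.natDegree ≤ k ∧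
    ∀ m : ℕ, 0 < m → (m : ℂ) * aeval (m : ℂ) P = (m.choose (k + 1) : ℂ) := by
  refine ⟨C (((k + 1).factorial : ℚ)⁻¹) * (descPochhammer ℚ k).comp (X - C 1), ?_, ?_⟩
  · refine (natDegree_C_mul_le _ _).trans ?_
    rw [natDegree_comp, natDegree_X_sub_C, mul_one, descPochhammer_natDegree]
  · intro m hm
    have h := congrArg (Nat.cast (R := ℚ)) (Nat.descFactorial_eq_factorial_mul_choose m (k + 1))
    rw [← descPochhammer_eval_eq_descFactorial, descPochhammer_succ_left] at h
    simp only [eval_mul, eval_X, eval_comp, eval_sub, eval_one] at h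
    have h2 : aeval (m : ℂ) (C (((k + 1).factorial : ℚ)⁻¹) * (descPochhammer ℚ k).comp (X - C 1)) =
        ((((k + 1).factorial : ℚ)⁻¹ * (descPochhammer ℚ k).eval ((m : ℚ) - 1) : ℚ) : ℂ) := by
      have : (m : ℂ) = algebraMap ℚ ℂ m := by simp
      rw [this, aeval_algebraMap_apply_eq_algebraMap_eval]
      simp [eval_comp]
    rw [h2]
    have h3 : (m : ℚ) * (((k + 1).factorial : ℚ)⁻¹ * (descPochhammer ℚ k).eval ((m : ℚ) - 1)) =
        m.choose (k + 1) := by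
      have := Nat.factorial_ne_zero (k + 1)
      field_simp
      push_cast at h
      linear_combination h
    exact_mod_cast congrArg (Rat.cast (K := ℂ)) h3

open Polynomial Finset in
theorem exists_polynomial_sum_cyclotomicInv_pow (k : ℕ) (hk : 0 < k) :
    ∃ P : ℚ[X], P.natDegree ≤ k ∧
      ∀ m : ℕ, 0 < m → ∑ j : Fin (m - 1), cyclotomicInv m j ^ k = aeval (m : ℂ) P := by
  induction k using Nat.strong_induction_on with
  | _ k ih =>
    -- The range conditions move inside the existential so that `choose` yields a total function,
    -- with value 0 allowed outside the range.
    have ih' : ∀ l, ∃ P : ℚ[X], 0 < l → l < k → P.natDegree ≤ l ∧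
        ∀ m : ℕ, 0 < m → ∑ j : Fin (m - 1), cyclotomicInv m j ^ l = aeval (m : ℂ) P := by
      intro l
      by_cases h : 0 < l ∧ l < k
      · obtain ⟨P, hP⟩ := ih l h.2 h.1
        exact ⟨P, fun _ _ => hP⟩
      · exact ⟨0, fun h1 h2 => absurd ⟨h1, h2⟩ h⟩
    choose F hF using ih'
    choose D hD hD' using exists_polynomial_choose_div
    -- Newton's identity for the k-th power sum, with D for the elementary symmetric functions and F
    -- for the lower power sums.
    refine ⟨(-1) ^ (k + 1) * (k : ℚ[X]) * D k -
      ∑ a ∈ antidiagonal k with a.1 ∈ Set.Ioo 0 k, (-1) ^ a.1 * D a.1 * F a.2, ?_, ?_⟩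
    · have hneg : ∀ i : ℕ, ((-1 : ℚ[X]) ^ i).natDegree = 0 := by
        intro i
        rcases neg_one_pow_eq_or ℚ[X] i with h | h <;> simp [h]
      refine (natDegree_sub_le_iff_left ?_).mpr ?_
      · refine natDegree_sum_le_of_forall_le _ _ fun a ha => ?_
        obtain ⟨ha1, ha2, ha3⟩ := mem_filter.mp ha
        rw [HasAntidiagonal.mem_antidiagonal] at ha1
        have h1 := natDegree_mul_le (p := (-1) ^ a.1 * D a.1) (q := F a.2)
        have h2 := natDegree_mul_le (p := (-1 : ℚ[X]) ^ a.1) (q := D a.1)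
        have h3 := hD a.1
        have h4 := (hF a.2 (by omega) (by omega)).1
        have h5 := hneg a.1
        omega
      · have h1 := natDegree_mul_le (p := (-1) ^ (k + 1) * (k : ℚ[X])) (q := D k)
        have h2 := natDegree_mul_le (p := (-1 : ℚ[X]) ^ (k + 1)) (q := (k : ℚ[X]))
        have h3 := hD k
        have h4 := hneg (k + 1)
        have h5 : (k : ℚ[X]).natDegree = 0 := natDegree_natCast k
        omega
    · intro m hm
      have hm' : (m : ℂ) ≠ 0 := by exact_mod_cast hm.ne'
      have he : ∀ l, MvPolynomial.aeval (fun j : Fin (m - 1) => cyclotomicInv m j)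
          (MvPolynomial.esymm (Fin (m - 1)) ℚ l) = aeval (m : ℂ) (D l) := fun l =>
        mul_left_cancel₀ hm' ((esymm_cyclotomicInv hm l).trans (hD' l m hm).symm)
      have hp : ∀ l, MvPolynomial.aeval (fun j : Fin (m - 1) => cyclotomicInv m j)
          (MvPolynomial.psum (Fin (m - 1)) ℚ l) = ∑ j : Fin (m - 1), cyclotomicInv m j ^ l := by
        intro l
        simp [MvPolynomial.psum]
      have h := congrArg (MvPolynomial.aeval (fun j : Fin (m - 1) => cyclotomicInv m j))
        (MvPolynomial.psum_eq_mul_esymm_sub_sum (Fin (m - 1)) ℚ k hk)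
      rw [hp] at h
      rw [h]
      simp only [map_sub, map_mul, map_pow, map_neg, map_one, map_natCast, map_sum, he, hp]
      congr 1
      refine sum_congr rfl fun a ha => ?_
      obtain ⟨ha1, ha2, ha3⟩ := mem_filter.mp ha
      rw [HasAntidiagonal.mem_antidiagonal] at ha1
      rw [(hF a.2 (by omega) (by omega)).2 m hm]

open Polynomial Finset in
/-- The power sums of `1 / sin² (π j / m)` are polynomials in `m`. -/
theorem exists_polynomial_sum_one_div_sin_pow (n : ℕ) (hn : 0 < n) :
    ∃ P : ℚ[X], P.natDegree ≤ 2 * n ∧ ∀ m : ℕ, 0 < m →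
      ∑ j ∈ range (m - 1), 1 / Real.sin (Real.pi * (j + 1) / m) ^ (2 * n) =
        aeval (m : ℝ) P := by
  choose F hF hF' using fun k => exists_polynomial_sum_cyclotomicInv_pow (k + 1) k.succ_pos
  refine ⟨∑ i ∈ range (n + 1), C ((4 : ℚ) ^ n * (-1) ^ i * (n.choose i : ℚ)) * F (n + i - 1),
    ?_, ?_⟩
  · refine natDegree_sum_le_of_forall_le _ _ fun i hi => ?_
    rw [mem_range] at hi
    refine (natDegree_C_mul_le _ _).trans ((hF _).trans (by omega))
  · intro m hm
    apply Complex.ofReal_injective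
    have hcast : ((aeval (m : ℝ) (∑ i ∈ range (n + 1),
        C ((4 : ℚ) ^ n * (-1) ^ i * (n.choose i : ℚ)) * F (n + i - 1)) : ℝ) : ℂ) =
        aeval (m : ℂ) (∑ i ∈ range (n + 1),
          C ((4 : ℚ) ^ n * (-1) ^ i * (n.choose i : ℚ)) * F (n + i - 1)) := by
      have := aeval_algebraMap_apply ℂ (m : ℝ) (∑ i ∈ range (n + 1),
        C ((4 : ℚ) ^ n * (-1) ^ i * (n.choose i : ℚ)) * F (n + i - 1))
      simpa using this.symm
    rw [hcast, Complex.ofReal_sum, map_sum]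
    have hj : ∀ j ∈ range (m - 1),
        ((1 / Real.sin (Real.pi * (j + 1) / m) ^ (2 * n) : ℝ) : ℂ) =
        ∑ i ∈ range (n + 1), (4 : ℂ) ^ n * (-1) ^ i * (n.choose i : ℂ) *
          cyclotomicInv m j ^ (n + i) := by
      intro j hj
      rw [mem_range] at hj
      have h1 : (1 / Real.sin (Real.pi * (j + 1) / m) ^ (2 * n) : ℝ) =
        (1 / Real.sin (Real.pi * (j + 1) / m) ^ 2) ^ n := by rw [pow_mul, div_pow, one_pow]
      rw [h1, Complex.ofReal_pow, ← four_mul_cyclotomicInv (by omega), mul_pow, mul_pow,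
        sub_eq_neg_add, add_pow, mul_sum, mul_sum]
      refine sum_congr rfl fun i _ => ?_
      rw [neg_pow, pow_add]
      ring
    rw [sum_congr rfl hj, sum_comm]
    refine sum_congr rfl fun i _ => ?_
    rw [← mul_sum, map_mul, aeval_C, ← hF' _ m hm, show n + i - 1 + 1 = n + i by omega,
      Fin.sum_univ_eq_sum_range (fun j => cyclotomicInv m j ^ (n + i))]
    simp

/-! ### Top coefficient of the power sums from zeta values -/

open Polynomial Filter Topology in
theorem tendsto_aeval_div_pow_atTop {P : ℚ[X]} {d : ℕ} (hP : P.natDegree ≤ d) :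
    Tendsto (fun x : ℝ => aeval x P / x ^ d) atTop (𝓝 (P.coeff d : ℝ)) := by
  have h1 : ∀ x : ℝ, aeval x P / x ^ d =
      (∑ i ∈ Finset.range d, (P.coeff i : ℝ) * (x ^ i / x ^ d)) +
        (P.coeff d : ℝ) * (x ^ d / x ^ d) := by
    intro x
    rw [aeval_eq_sum_range' (Nat.lt_succ_of_le hP), Finset.sum_div, Finset.sum_range_succ]
    simp only [Algebra.smul_def, eq_ratCast, mul_div_assoc]
  simp_rw [h1]
  have h2 : Tendsto (fun x : ℝ => ∑ i ∈ Finset.range d, (P.coeff i : ℝ) * (x ^ i / x ^ d))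
      atTop (𝓝 (∑ i ∈ Finset.range d, (P.coeff i : ℝ) * 0)) :=
    tendsto_finsetSum _ fun i hi =>
      (tendsto_pow_div_pow_atTop_zero (Finset.mem_range.mp hi)).const_mul _
  have h3 : Tendsto (fun x : ℝ => (P.coeff d : ℝ) * (x ^ d / x ^ d)) atTop
      (𝓝 (P.coeff d : ℝ)) := by
    refine tendsto_const_nhds.congr' ?_
    filter_upwards [eventually_gt_atTop 0] with x hx
    rw [div_self (pow_pos hx d).ne', mul_one]
  simpa using h2.add h3

theorem sin_reflect_pow {m : ℕ} (n : ℕ) {j : ℕ} (hj : j + 1 < m) :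
    Real.sin (Real.pi * ((m - 2 - j : ℕ) + 1) / m) ^ n =
      Real.sin (Real.pi * (j + 1) / m) ^ n := by
  have hm : (m : ℝ) ≠ 0 := by exact_mod_cast (by omega : m ≠ 0)
  rw [← Real.sin_pi_sub]
  congr 2
  rw [Nat.sub_sub, Nat.cast_sub (by omega)]
  push_cast
  field_simp
  ring

open Finset in
theorem two_mul_sum_range_half_of_odd {m : ℕ} (hm : Odd m) (n : ℕ) :
    2 * ∑ j ∈ range (m / 2), 1 / Real.sin (Real.pi * (j + 1) / m) ^ n =
      ∑ j ∈ range (m - 1), 1 / Real.sin (Real.pi * (j + 1) / m) ^ n := by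
  have h := Nat.odd_iff.mp hm
  rw [show m - 1 = m / 2 + m / 2 by omega, sum_range_add, two_mul]
  congr 1
  rw [← sum_range_reflect]
  refine sum_congr rfl fun j hj => ?_
  rw [mem_range] at hj
  rw [← sin_reflect_pow n (show m / 2 + j + 1 < m by omega),
    show m - 2 - (m / 2 + j) = m / 2 - 1 - j by omega]

-- The reflection j ↦ m - 2 - j fixes the middle term, whose sine is 1; doubling the half sum counts
-- it once too often.
open Finset in
theorem two_mul_sum_range_half_of_even {m : ℕ} (hm : Even m) (hm0 : 0 < m) (n : ℕ) :
    2 * ∑ j ∈ range (m / 2), 1 / Real.sin (Real.pi * (j + 1) / m) ^ n =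
      (∑ j ∈ range (m - 1), 1 / Real.sin (Real.pi * (j + 1) / m) ^ n) + 1 := by
  have h := Nat.even_iff.mp hm
  have h1 : ∑ j ∈ range (m / 2), 1 / Real.sin (Real.pi * (j + 1) / m) ^ n =
      ∑ j ∈ range (m / 2 - 1), 1 / Real.sin (Real.pi * (j + 1) / m) ^ n + 1 := by
    obtain ⟨i, hi⟩ : ∃ i, m / 2 = i + 1 := ⟨m / 2 - 1, by omega⟩
    rw [hi, sum_range_succ, Nat.add_sub_cancel]
    have : (m : ℝ) = 2 * (i + 1) := by exact_mod_cast (by omega : m = 2 * (i + 1))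
    have h2 : Real.pi * ((i : ℝ) + 1) / m = Real.pi / 2 := by
      have : (i : ℝ) + 1 ≠ 0 := by positivity
      rw [‹(m : ℝ) = _›]
      field_simp
    rw [h2, Real.sin_pi_div_two, one_pow, div_one]
  have h2 : ∑ j ∈ range (m / 2 - 1), 1 / Real.sin (Real.pi * ((m / 2 + j : ℕ) + 1) / m) ^ n =
      ∑ j ∈ range (m / 2 - 1), 1 / Real.sin (Real.pi * (j + 1) / m) ^ n := by
    rw [← sum_range_reflect]
    refine sum_congr rfl fun j hj => ?_
    rw [mem_range] at hj
    rw [← sin_reflect_pow n (show j + 1 < m by omega),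
      show m - 2 - j = m / 2 + (m / 2 - 1 - 1 - j) by omega]
  rw [show m - 1 = m / 2 + (m / 2 - 1) by omega, sum_range_add, h2, two_mul]
  linarith

-- With m = 2i + 1, each m sin(π(j+1)/m) tends to π(j+1), and dominated convergence gives
-- ζ(2n)/π^(2n).
open Finset Filter Topology in
theorem tendsto_sum_one_div_mul_sin_pow {n : ℕ} (hn : n ≠ 0) :
    Tendsto (fun i : ℕ => ∑ j ∈ range i,
        1 / (((2 * i + 1 : ℕ) : ℝ) * Real.sin (Real.pi * (j + 1) / (2 * i + 1 : ℕ))) ^ (2 * n))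
      atTop (𝓝 ((-1 : ℝ) ^ (n + 1) * (2 : ℝ) ^ (2 * n - 1) * bernoulli (2 * n) /
        (2 * n).factorial)) := by
  have hz := hasSum_zeta_nat hn
  have hz1 : HasSum (fun j : ℕ => 1 / (Real.pi * ((j : ℝ) + 1)) ^ (2 * n))
      ((-1 : ℝ) ^ (n + 1) * (2 : ℝ) ^ (2 * n - 1) * bernoulli (2 * n) / (2 * n).factorial) := by
    -- The index is shifted by one; the discarded term 1/0^(2n) is 0 by convention.
    have h1 := (hasSum_nat_add_iff' 1).mpr hz
    have h2 := h1.mul_left ((Real.pi ^ (2 * n))⁻¹)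
    convert! h2 using 1
    · funext j
      rw [mul_pow]
      push_cast
      field_simp
    · simp only [range_one, sum_singleton, Nat.cast_zero]
      rw [zero_pow (by omega), div_zero, sub_zero]
      field_simp
  rw [← hz1.tsum_eq]
  have hfin : ∀ i : ℕ, ∑ j ∈ range i,
        1 / (((2 * i + 1 : ℕ) : ℝ) * Real.sin (Real.pi * (j + 1) / (2 * i + 1 : ℕ))) ^ (2 * n) =
      ∑' j, if j < i then
        1 / (((2 * i + 1 : ℕ) : ℝ) * Real.sin (Real.pi * (j + 1) / (2 * i + 1 : ℕ))) ^ (2 * n)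
        else 0 := by
    intro i
    rw [tsum_eq_sum (s := range i) (fun j hj => if_neg (by simpa using hj))]
    exact sum_congr rfl fun j hj => (if_pos (mem_range.mp hj)).symm
  simp_rw [hfin]
  have hsum : Summable (fun j : ℕ => 1 / ((j : ℝ) + 1) ^ (2 * n)) := by
    have := (summable_nat_add_iff 1).mpr hz.summable
    simpa using this
  refine tendsto_tsum_of_dominated_convergence hsum ?_ ?_
  · intro j
    have hlim : Tendsto (fun i : ℕ => ((2 * i + 1 : ℕ) : ℝ) *
        Real.sin (Real.pi * (j + 1) / (2 * i + 1 : ℕ))) atTop (𝓝 (Real.pi * (j + 1))) := by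
      have hodd : Tendsto (fun i : ℕ => ((2 * i + 1 : ℕ) : ℝ)) atTop atTop := by
        refine tendsto_natCast_atTop_atTop.comp (tendsto_atTop_mono (fun i => ?_) tendsto_id)
        simp only [id]; omega
      have hslope : Tendsto (fun x : ℝ => x⁻¹ * Real.sin (Real.pi * (j + 1) * x)) (𝓝[≠] 0)
          (𝓝 (Real.pi * (j + 1))) := by
        have hd : HasDerivAt (fun x : ℝ => Real.sin (Real.pi * (j + 1) * x))
            (Real.pi * (j + 1)) 0 := by
          have := ((hasDerivAt_id (0 : ℝ)).const_mul (Real.pi * ((j : ℝ) + 1))).sin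
          simpa using this
        have := hd.tendsto_slope_zero
        simpa using this
      have hinv : Tendsto (fun i : ℕ => (((2 * i + 1 : ℕ) : ℝ))⁻¹) atTop (𝓝[≠] 0) := by
        refine tendsto_nhdsWithin_iff.mpr ⟨tendsto_inv_atTop_zero.comp hodd,
          Eventually.of_forall fun i => ?_⟩
        simp only [Set.mem_compl_iff, Set.mem_singleton_iff, inv_eq_zero]
        positivity
      have := hslope.comp hinv
      simpa [Function.comp_def, div_eq_mul_inv] using this
    have hpos : (Real.pi * ((j : ℝ) + 1)) ^ (2 * n) ≠ 0 := by
      have := Real.pi_pos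
      positivity
    refine ((hlim.pow (2 * n)).inv₀ hpos |>.congr' ?_).trans_eq ?_
    · filter_upwards [eventually_gt_atTop j] with i hi
      rw [if_pos hi, one_div]
    · rw [one_div]
  · refine Eventually.of_forall fun i j => ?_
    split_ifs with h
    · have hM : (0 : ℝ) < ((2 * i + 1 : ℕ) : ℝ) := by positivity
      have hle : (j : ℝ) + 1 ≤ ((2 * i + 1 : ℕ) : ℝ) *
          Real.sin (Real.pi * (j + 1) / (2 * i + 1 : ℕ)) := by
        have hij : 2 * ((j : ℝ) + 1) ≤ ((2 * i + 1 : ℕ) : ℝ) := by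
          exact_mod_cast (by omega : 2 * (j + 1) ≤ 2 * i + 1)
        have hpi := Real.pi_pos
        -- Jordan's inequality sin x ≥ 2x/π applies because the angle is at most π/2 when j < i.
        have := Real.mul_le_sin (x := Real.pi * (j + 1) / (2 * i + 1 : ℕ)) (by positivity) (by
          rw [div_le_div_iff₀ hM two_pos]
          nlinarith)
        calc (j : ℝ) + 1 ≤ 2 * (j + 1) := by linarith [Nat.cast_nonneg (α := ℝ) j]
          _ = ((2 * i + 1 : ℕ) : ℝ) *
              (2 / Real.pi * (Real.pi * (j + 1) / (2 * i + 1 : ℕ))) := by field_simp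
          _ ≤ _ := mul_le_mul_of_nonneg_left this hM.le
      have h0 : (0 : ℝ) < (j : ℝ) + 1 := by positivity
      rw [Real.norm_of_nonneg (by have := h0.trans_le hle; positivity)]
      exact one_div_le_one_div_of_le (by positivity) (pow_le_pow_left₀ h0.le hle _)
    · simp only [norm_zero]
      positivity

-- Odd m suffice to find the coefficient as the limit of P(m)/m^(2n); there the full sum is exactly
-- twice the half sum.
open Polynomial Finset Filter Topology in
theorem coeff_eq_of_sum_one_div_sin_pow {n : ℕ} (hn : n ≠ 0) {P : ℚ[X]}
    (hdeg : P.natDegree ≤ 2 * n)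
    (hP : ∀ m : ℕ, 0 < m →
      ∑ j ∈ range (m - 1), 1 / Real.sin (Real.pi * (j + 1) / m) ^ (2 * n) = aeval (m : ℝ) P) :
    P.coeff (2 * n) = (-1) ^ (n + 1) * 2 ^ (2 * n) * _root_.bernoulli (2 * n) / (2 * n).factorial := by
  have hodd : Tendsto (fun i : ℕ => ((2 * i + 1 : ℕ) : ℝ)) atTop atTop := by
    refine tendsto_natCast_atTop_atTop.comp (tendsto_atTop_mono (fun i => ?_) tendsto_id)
    simp only [id]; omega
  have h1 := (tendsto_aeval_div_pow_atTop hdeg).comp hodd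
  have h2 := (tendsto_sum_one_div_mul_sin_pow hn).const_mul 2
  have heq : ∀ i : ℕ, 2 * ∑ j ∈ range i,
        1 / (((2 * i + 1 : ℕ) : ℝ) * Real.sin (Real.pi * (j + 1) / (2 * i + 1 : ℕ))) ^ (2 * n) =
      aeval ((2 * i + 1 : ℕ) : ℝ) P / ((2 * i + 1 : ℕ) : ℝ) ^ (2 * n) := by
    intro i
    rw [← hP _ (by omega), ← two_mul_sum_range_half_of_odd ⟨i, rfl⟩,
      show (2 * i + 1) / 2 = i by omega, mul_div_assoc, sum_div]
    congr 1
    refine sum_congr rfl fun j _ => ?_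
    rw [mul_pow, div_div, mul_comm]
  simp_rw [heq] at h2
  have h3 := tendsto_nhds_unique h1 h2
  have h4 : (2 : ℝ) ^ (2 * n) = 2 * 2 ^ (2 * n - 1) := by
    rw [← pow_succ']
    congr 1
    omega
  have : ((P.coeff (2 * n) : ℚ) : ℝ) = (((-1) ^ (n + 1) * 2 ^ (2 * n) * _root_.bernoulli (2 * n) /
      (2 * n).factorial : ℚ) : ℝ) := by
    rw [h3]
    push_cast
    rw [h4]
    ring
  exact_mod_cast this

/-- Otherwise ζ(2n), a sum of nonnegative terms, would vanish although its term at 1 is 1. This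
makes the degrees of the counting polynomials exact. -/
theorem bernoulli_two_mul_ne_zero {n : ℕ} (hn : n ≠ 0) : bernoulli (2 * n) ≠ 0 := by
  intro h0
  have hz := hasSum_zeta_nat hn
  rw [h0] at hz
  simp only [Rat.cast_zero, mul_zero, zero_div] at hz
  have := (hasSum_zero_iff_of_nonneg (fun i => by positivity)).mp hz
  simpa using congrFun this 1

/-! ### Splitting the condition at p² into bounds p and 2p -/

/-- The representative of `a` modulo `p`, up to the reflection `r ↦ p - 1 - r`, in the lower half
of the residues. -/
def foldMod (p a : ℕ) : ℕ := if a % p ≤ p / 2 then a % p else p - 1 - a % p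

/-- Twice the quotient of `a` by `p`, rounded up by one in the upper half of the residues. -/
def halfDiv (p a : ℕ) : ℕ := if a % p ≤ p / 2 then 2 * (a / p) else 2 * (a / p) + 1

/-- The number with a given `halfDiv` and `foldMod`. -/
def unfoldMod (p t x : ℕ) : ℕ := p * (x / 2) + if x % 2 = 0 then t else p - 1 - t

theorem unfoldMod_foldMod {p : ℕ} (hp : 0 < p) (a : ℕ) :
    unfoldMod p (foldMod p a) (halfDiv p a) = a := by
  have h1 := Nat.div_add_mod a p
  have h2 := Nat.mod_lt a hp
  unfold unfoldMod foldMod halfDiv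
  split_ifs with h h3 h3
  · rw [Nat.mul_div_cancel_left _ two_pos, h1]
  · omega
  · omega
  · rw [show (2 * (a / p) + 1) / 2 = a / p by omega]
    omega

theorem unfoldMod_div_mod {p t : ℕ} (ht : t < p / 2) (x : ℕ) :
    unfoldMod p t x / p = x / 2 ∧
      unfoldMod p t x % p = if x % 2 = 0 then t else p - 1 - t := by
  unfold unfoldMod
  have hlt : (if x % 2 = 0 then t else p - 1 - t) < p := by split_ifs <;> omega
  constructor
  · rw [Nat.mul_add_div (by omega), Nat.div_eq_of_lt hlt, add_zero]
  · rw [Nat.mul_add_mod, Nat.mod_eq_of_lt hlt]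

/-- The strict bound excludes the residue (p-1)/2, which the reflection fixes and where the parity
of x would be lost. -/
theorem foldMod_unfoldMod {p t : ℕ} (hp : Odd p) (ht : t < p / 2) (x : ℕ) :
    foldMod p (unfoldMod p t x) = t := by
  obtain ⟨-, h⟩ := unfoldMod_div_mod ht x
  have := Nat.odd_iff.mp hp
  unfold foldMod
  rw [h]
  split_ifs <;> omega

theorem halfDiv_unfoldMod {p t : ℕ} (hp : Odd p) (ht : t < p / 2) (x : ℕ) :
    halfDiv p (unfoldMod p t x) = x := by
  obtain ⟨h1, h2⟩ := unfoldMod_div_mod ht x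
  have := Nat.odd_iff.mp hp
  unfold halfDiv
  rw [h1, h2]
  split_ifs <;> omega

theorem exists_digits {p : ℕ} (hp : 0 < p) (a : ℕ) : ∃ q : ℤ, (a : ℤ) = p * q + a % p ∧
    ((halfDiv p a : ℤ) = 2 * q ∧ ((a % p : ℕ) : ℤ) = foldMod p a ∨
      (halfDiv p a : ℤ) = 2 * q + 1 ∧ ((a % p : ℕ) : ℤ) = p - 1 - foldMod p a) := by
  refine ⟨(a / p : ℕ), ?_, ?_⟩
  · exact_mod_cast (Nat.div_add_mod a p).symm
  · have h2 := Nat.mod_lt a hp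
    unfold halfDiv foldMod
    split_ifs
    · left; simp
    · right
      push_cast [Nat.cast_sub (show a % p ≤ p - 1 by omega), Nat.cast_sub (show 1 ≤ p by omega)]
      exact ⟨rfl, by ring⟩

/-- Each inequality compares p times an integer combination D of quotients with a combination of
residues. Large |D| decides it alone; in the borderline cases the balance of the folded residues
decides, exactly as the parities of the doubled quotients do. -/
theorem isBalanced_sq_iff {p : ℕ} (hp : 0 < p) {s : Fin 3 → ℕ}
    (h : IsBalanced p (foldMod p ∘ s)) :
    IsBalanced (p ^ 2) s ↔ IsBalanced (2 * p) (halfDiv p ∘ s) := by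
  obtain ⟨q0, hq0, h0⟩ := exists_digits hp (s 0)
  obtain ⟨q1, hq1, h1⟩ := exists_digits hp (s 1)
  obtain ⟨q2, hq2, h2⟩ := exists_digits hp (s 2)
  -- The residue combinations lie strictly between -2p and 3p, so only D from -1 to 2 needs exact
  -- values of pD; this makes every case linear.
  have mulcases : ∀ D : ℤ, (D ≤ -2 ∧ p * D ≤ -2 * p) ∨ (D = -1 ∧ p * D = -p) ∨
      (D = 0 ∧ p * D = 0) ∨ (D = 1 ∧ p * D = p) ∨ (D = 2 ∧ p * D = 2 * p) ∨
      (3 ≤ D ∧ 3 * p ≤ p * D) := by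
    intro D
    have hp' : (0 : ℤ) ≤ p := by positivity
    rcases lt_or_ge D (-1) with hD | hD
    · left; exact ⟨by omega, by nlinarith⟩
    rcases lt_or_ge 2 D with hD' | hD'
    · iterate 5 right
      exact ⟨by omega, by nlinarith⟩
    have : D = -1 ∨ D = 0 ∨ D = 1 ∨ D = 2 := by omega
    rcases this with rfl | rfl | rfl | rfl <;> simp <;> omega
  have m0 := mulcases (q1 + q2 - q0)
  have m1 := mulcases (q0 + q2 - q1)
  have m2 := mulcases (q0 + q1 - q2)
  have m3 := mulcases (p - (q0 + q1 + q2))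
  have hp2 : ((p ^ 2 : ℕ) : ℤ) = p * p := by push_cast; ring
  simp only [IsBalanced, Function.comp_apply, abs_le, hp2] at h ⊢
  simp only [mul_add, mul_sub] at m0 m1 m2 m3
  push_cast at h0 h1 h2 ⊢
  generalize (p : ℤ) * p = pp at *
  generalize (p : ℤ) * q0 = w0 at *
  generalize (p : ℤ) * q1 = w1 at *
  generalize (p : ℤ) * q2 = w2 at *
  generalize (s 0 : ℤ) % p = r0 at *
  generalize (s 1 : ℤ) % p = r1 at *
  generalize (s 2 : ℤ) % p = r2 at *
  generalize halfDiv p (s 0) = x0 at *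
  generalize halfDiv p (s 1) = x1 at *
  generalize halfDiv p (s 2) = x2 at *
  generalize foldMod p (s 0) = t0 at *
  generalize foldMod p (s 1) = t1 at *
  generalize foldMod p (s 2) = t2 at *
  have e0 : (s 0 : ℤ) ≤ s 1 + s 2 ↔ (x0 : ℤ) ≤ x1 + x2 := by
    clear m1 m2 m3
    rcases h0 with ⟨h0, h0'⟩ | ⟨h0, h0'⟩ <;> rcases h1 with ⟨h1, h1'⟩ | ⟨h1, h1'⟩ <;>
      rcases h2 with ⟨h2, h2'⟩ | ⟨h2, h2'⟩ <;> omega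
  have e1 : (s 1 : ℤ) ≤ s 0 + s 2 ↔ (x1 : ℤ) ≤ x0 + x2 := by
    clear m0 m2 m3 e0
    rcases h0 with ⟨h0, h0'⟩ | ⟨h0, h0'⟩ <;> rcases h1 with ⟨h1, h1'⟩ | ⟨h1, h1'⟩ <;>
      rcases h2 with ⟨h2, h2'⟩ | ⟨h2, h2'⟩ <;> omega
  have e2 : (s 2 : ℤ) ≤ s 0 + s 1 ↔ (x2 : ℤ) ≤ x0 + x1 := by
    clear m0 m1 m3 e0 e1
    rcases h0 with ⟨h0, h0'⟩ | ⟨h0, h0'⟩ <;> rcases h1 with ⟨h1, h1'⟩ | ⟨h1, h1'⟩ <;>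
      rcases h2 with ⟨h2, h2'⟩ | ⟨h2, h2'⟩ <;> omega
  have e3 : (s 0 : ℤ) + s 1 + s 2 ≤ pp - 2 ↔ (x0 : ℤ) + x1 + x2 ≤ 2 * p - 2 := by
    clear m0 m1 m2 e0 e1 e2
    rcases h0 with ⟨h0, h0'⟩ | ⟨h0, h0'⟩ <;> rcases h1 with ⟨h1, h1'⟩ | ⟨h1, h1'⟩ <;>
      rcases h2 with ⟨h2, h2'⟩ | ⟨h2, h2'⟩ <;> omega
  clear h h0 h1 h2 m0 m1 m2 m3 hq0 hq1 hq2 mulcases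
  omega

theorem mem_daggerC_two_iff {p : ℕ} (hodd : Odd p) {s : Fin 3 → ℕ} :
    s ∈ daggerC p 2 ↔ IsBalanced p (foldMod p ∘ s) ∧ IsBalanced (2 * p) (halfDiv p ∘ s) := by
  have hp := hodd.pos
  have hp2 := Nat.odd_iff.mp hodd
  constructor
  · rintro ⟨h1, h2⟩
    obtain ⟨s', hs', hb⟩ := h2 1 one_pos one_lt_two
    rw [pow_one] at hb
    -- Entries of a balanced triple are below p/2, and for odd p at most one of r and p - 1 - r is,
    -- so the choice is forced.
    have : s' = foldMod p ∘ s := by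
      funext i
      have h3 := hb.lt_half i
      have h4 := hs' i
      rw [pow_one] at h4
      have h5 := Nat.mod_lt (s i) hp
      simp only [Function.comp_apply, foldMod]
      split_ifs <;> omega
    rw [this] at hb
    exact ⟨hb, (isBalanced_sq_iff hp hb).mp h1⟩
  · rintro ⟨h1, h2⟩
    refine ⟨(isBalanced_sq_iff hp h1).mpr h2, fun N' hN hN' => ?_⟩
    obtain rfl : N' = 1 := by omega
    refine ⟨foldMod p ∘ s, fun i => ?_, by rwa [pow_one]⟩
    simp only [Function.comp_apply, foldMod, pow_one]
    split_ifs <;> simp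

namespace BranchGraph

variable {V E : Type*} {G : BranchGraph V E}

theorem mem_Ed_two_iff {p : ℕ} (hp : Odd p) {a : E → ℕ} :
    a ∈ G.Ed p 2 ↔ foldMod p ∘ a ∈ G.balancedNumberings p ∧
      halfDiv p ∘ a ∈ G.balancedNumberings (2 * p) := by
  simp only [Ed, balancedNumberings, Set.mem_ofPred_eq, mem_daggerC_two_iff hp, ← forall_and]
  rfl

/-- The two digits are independent: every pair of balanced numberings occurs, since balance at p
gives the bound t < p/2 under which the digits can be recovered. -/
theorem ncard_Ed_two (htri : G.IsTrivalent) {p : ℕ} (hp : Odd p) :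
    (G.Ed p 2).ncard = (G.balancedNumberings p).ncard * (G.balancedNumberings (2 * p)).ncard := by
  have hinj : Function.Injective (fun a : E → ℕ => (foldMod p ∘ a, halfDiv p ∘ a)) := by
    intro a b hab
    obtain ⟨h1, h2⟩ := Prod.mk.inj hab
    funext e
    rw [← unfoldMod_foldMod hp.pos (a e), ← unfoldMod_foldMod hp.pos (b e),
      show foldMod p (a e) = foldMod p (b e) from congrFun h1 e,
      show halfDiv p (a e) = halfDiv p (b e) from congrFun h2 e]
  rw [← Set.ncard_prod, ← Set.ncard_image_of_injective _ hinj]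
  congr 1
  ext ⟨t, x⟩
  simp only [Set.mem_image, Prod.mk.injEq, Set.mem_prod]
  constructor
  · rintro ⟨a, ha, rfl, rfl⟩
    exact (mem_Ed_two_iff hp).mp ha
  · rintro ⟨ht, hx⟩
    have hlt := balancedNumberings_lt_half htri ht
    have h1 : (foldMod p ∘ fun e => unfoldMod p (t e) (x e)) = t :=
      funext fun e => foldMod_unfoldMod hp (hlt e) _
    have h2 : (halfDiv p ∘ fun e => unfoldMod p (t e) (x e)) = x :=
      funext fun e => halfDiv_unfoldMod hp (hlt e) _
    exact ⟨fun e => unfoldMod p (t e) (x e),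
      (mem_Ed_two_iff hp).mpr ⟨by rwa [h1], by rwa [h2]⟩, h1, h2⟩

end BranchGraph

/-! ### Counting polynomials for odd and even bounds -/

namespace BranchGraph

variable {V E : Type*} {G : BranchGraph V E}

open Polynomial Finset in
/-- For a trivalent connected graph of genus `n + 1`, the number of balanced numberings is given
by one polynomial at odd bounds and another one at even bounds. -/
theorem exists_polynomial_ncard_balancedNumberings [Finite V] [Finite E] {n : ℕ} (hn : n ≠ 0)
    (hconn : G.IsConnected) (htri : G.IsTrivalent) (hgenus : G.bettiOne = n + 1) :
    ∃ A B : ℚ[X], A.natDegree ≤ 3 * n ∧ B.natDegree ≤ 3 * n ∧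
      A.coeff (3 * n) =
        (-1) ^ (n + 1) * _root_.bernoulli (2 * n) / (2 * ((2 * n).factorial : ℚ)) ∧
      B.coeff (3 * n) = A.coeff (3 * n) ∧
      (∀ m : ℕ, Odd m → ((G.balancedNumberings m).ncard : ℚ) = A.eval (m : ℚ)) ∧
      (∀ m : ℕ, Even m → 0 < m → ((G.balancedNumberings m).ncard : ℚ) = B.eval (m : ℚ)) := by
  have := Fintype.ofFinite V
  have := Fintype.ofFinite E
  obtain ⟨hV, hE⟩ := card_vertices_edges hconn htri hgenus
  rw [Nat.add_sub_cancel] at hV hE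
  obtain ⟨P, hP, hPsum⟩ := exists_polynomial_sum_one_div_sin_pow n (Nat.pos_of_ne_zero hn)
  have hPc := coeff_eq_of_sum_one_div_sin_pow hn hP hPsum
  have hterm : ∀ m j : ℕ, 0 < m → columnNorm m j ^ (3 * n) *
      ((columnNorm m j * oddSine m 0 j)⁻¹) ^ (2 * n) =
      columnNorm m j ^ n * (1 / Real.sin (Real.pi * (j + 1) / m) ^ (2 * n)) := by
    intro m j hm
    have hc := (columnNorm_pos hm j).ne'
    have : oddSine m 0 j = Real.sin (Real.pi * (j + 1) / m) := by simp [oddSine]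
    rw [this, inv_pow, mul_pow, show 3 * n = n + 2 * n by ring, pow_add, mul_inv, one_div]
    field_simp
  have heval : ∀ (Q : ℚ[X]) (m : ℕ), ((Q.eval (m : ℚ) : ℚ) : ℝ) = aeval (m : ℝ) Q := by
    intro Q m
    have := aeval_algebraMap_apply_eq_algebraMap_eval (A := ℝ) (m : ℚ) Q
    simpa using this.symm
  have hcoeff : ∀ Q : ℚ[X], (C ((2 * 4 ^ n : ℚ)⁻¹) * (X ^ n * Q)).coeff (3 * n) =
      (2 * 4 ^ n : ℚ)⁻¹ * Q.coeff (2 * n) := by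
    intro Q
    rw [coeff_C_mul, show 3 * n = 2 * n + n by ring, coeff_X_pow_mul]
  have hdeg : ∀ Q : ℚ[X], Q.natDegree ≤ 2 * n →
      (C ((2 * 4 ^ n : ℚ)⁻¹) * (X ^ n * Q)).natDegree ≤ 3 * n := by
    intro Q hQ
    refine (natDegree_C_mul_le _ _).trans (natDegree_mul_le.trans ?_)
    rw [natDegree_X_pow]
    omega
  have hdegC : (C ((2 ^ n : ℚ)⁻¹) * X ^ n).natDegree < 3 * n :=
    (natDegree_C_mul_X_pow_le _ _).trans_lt (by omega)
  -- For odd m all norms are m/4 and the half sum is P/2. For even m the middle column has sine 1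
  -- and norm m/2: it contributes (m/2)^n and leaves (P - 1)/2 for the others.
  refine ⟨C ((2 * 4 ^ n : ℚ)⁻¹) * (X ^ n * P),
    C ((2 * 4 ^ n : ℚ)⁻¹) * (X ^ n * (P - C 1)) + C ((2 ^ n : ℚ)⁻¹) * X ^ n,
    hdeg P hP, ?_, ?_, ?_, ?_, ?_⟩
  · exact natDegree_add_le_of_degree_le (hdeg _ (by rwa [natDegree_sub_C])) hdegC.le
  · rw [hcoeff, hPc, show (2 : ℚ) ^ (2 * n) = 4 ^ n by rw [pow_mul]; norm_num]
    field_simp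
  · rw [coeff_add, coeff_eq_zero_of_natDegree_lt hdegC, add_zero, hcoeff, hcoeff, coeff_sub,
      coeff_C_of_ne_zero (by omega), sub_zero]
  · intro m hm
    apply Rat.cast_injective (α := ℝ)
    rw [heval, Rat.cast_natCast, ncard_balancedNumberings hconn htri, hV, hE]
    have hc : ∀ j, columnNorm m j = m / 4 := by
      intro j
      have := Nat.odd_iff.mp hm
      rw [columnNorm, if_neg (by omega)]
    simp_rw [hterm m _ hm.pos, hc]
    have h2 := two_mul_sum_range_half_of_odd hm (2 * n)
    rw [hPsum m hm.pos] at h2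
    rw [← mul_sum]
    simp only [map_mul, map_pow, aeval_C, aeval_X, eq_ratCast]
    rw [← h2, div_pow]
    push_cast
    field_simp
  · intro m hm hm0
    apply Rat.cast_injective (α := ℝ)
    rw [heval, Rat.cast_natCast, ncard_balancedNumberings hconn htri, hV, hE]
    have h2 := two_mul_sum_range_half_of_even hm hm0 (2 * n)
    rw [hPsum m hm0] at h2
    have hm2 := Nat.even_iff.mp hm
    obtain ⟨i, hi⟩ : ∃ i, m / 2 = i + 1 := ⟨m / 2 - 1, by omega⟩
    have hmi : (m : ℝ) = 2 * (i + 1) := by exact_mod_cast (by omega : m = 2 * (i + 1))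
    have hsin : Real.sin (Real.pi * ((i : ℝ) + 1) / m) = 1 := by
      have : (i : ℝ) + 1 ≠ 0 := by positivity
      rw [hmi, show Real.pi * ((i : ℝ) + 1) / (2 * (i + 1)) = Real.pi / 2 by field_simp,
        Real.sin_pi_div_two]
    have hc : ∀ j ∈ range i, columnNorm m j ^ n *
        (1 / Real.sin (Real.pi * (j + 1) / m) ^ (2 * n)) =
        ((m : ℝ) / 4) ^ n * (1 / Real.sin (Real.pi * (j + 1) / m) ^ (2 * n)) := by
      intro j hj
      rw [mem_range] at hj
      rw [columnNorm, if_neg (by omega)]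
    have hci : columnNorm m i = m / 2 := by rw [columnNorm, if_pos (by omega)]
    simp_rw [hterm m _ hm0]
    rw [hi, sum_range_succ] at h2 ⊢
    rw [sum_congr rfl hc, ← mul_sum, hci]
    rw [hsin, one_pow, div_one] at h2 ⊢
    have h3 : ∑ j ∈ range i, 1 / Real.sin (Real.pi * (j + 1) / m) ^ (2 * n) =
        (aeval (m : ℝ) P - 1) / 2 := by linarith
    rw [h3]
    simp only [map_add, map_sub, map_mul, map_pow, aeval_C, aeval_X, eq_ratCast]
    rw [div_pow, div_pow]
    push_cast
    field_simp

end BranchGraph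

/-! ### Quasi-polynomials determined by odd primes -/

namespace QuasiPolynomial

/-- A polynomial, seen as a quasi-polynomial of period one. -/
noncomputable def ofPolynomial (P : ℚ[X]) : QuasiPolynomial where
  constituent _ := P
  exists_period := ⟨1, one_pos, fun _ => rfl⟩

theorem hasDegree_ofPolynomial {P : ℚ[X]} {d : ℕ} (hP : P.natDegree ≤ d) (h : P.coeff d ≠ 0) :
    (ofPolynomial P).HasDegree d :=
  ⟨⟨0, h⟩, fun _ hi _ => Polynomial.coeff_eq_zero_of_natDegree_lt (hP.trans_lt hi)⟩

/-- A quasi-polynomial of period `4` that agrees with a polynomial at the odd primes has this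
polynomial as its constituent at every odd integer. -/
theorem constituent_eq_of_forall_prime {H : QuasiPolynomial}
    (hper : Function.Periodic H.constituent 4) {P : ℚ[X]}
    (h : ∀ p : ℕ, p.Prime → Odd p → H.eval p = P.eval (p : ℚ)) {t : ℤ} (ht : Odd t) :
    H.constituent t = P := by
  have hunit : IsUnit ((t : ℤ) : ZMod 4) := by
    rw [ZMod.coe_int_isUnit_iff_isCoprime]
    have : IsCoprime t 2 := Int.isCoprime_two_right.mpr ht
    have h4 := this.symm.pow_left (m := 2)
    norm_num at h4
    exact h4
  -- By Dirichlet, the class of t modulo 4 contains infinitely many primes; all of them share the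
  -- constituent at t.
  have hinf := Nat.infinite_setOfPred_prime_and_eq_mod hunit
  apply Polynomial.eq_of_infinite_eval_eq
  refine ((hinf.sdiff (Set.finite_singleton 2)).image (f := fun p : ℕ => (p : ℚ))
    (Nat.cast_injective.injOn)).mono ?_
  rintro _ ⟨p, ⟨⟨hp, hpt⟩, hp2⟩, rfl⟩
  have hodd : Odd p := hp.odd_of_ne_two hp2
  have hmod : H.constituent p = H.constituent t := by
    have hd : (4 : ℤ) ∣ t - p := by
      have := (ZMod.intCast_eq_intCast_iff_dvd_sub (p : ℤ) t 4).mp (by simpa using hpt)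
      exact_mod_cast this
    obtain ⟨k, hk⟩ := hd
    have := hper.int_mul k (p : ℤ)
    rw [← this]
    congr 1
    simp only [Int.cast_id]
    linarith
  have := h p hp hodd
  rw [QuasiPolynomial.eval, hmod] at this
  simpa using this

end QuasiPolynomial

/-- A single polynomial valid at odd primes, taken as a quasi-polynomial of period 1, is a witness,
and it is the constituent of any other one at odd integers. -/
theorem exists_isCountingQuasiPolynomial {V E : Type*} {G : BranchGraph V E} {g N : ℕ} {P : ℚ[X]}
    {c : ℚ} (hdeg : P.natDegree ≤ (3 * g - 3) * N) (hc : P.coeff ((3 * g - 3) * N) = c)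
    (hc0 : c ≠ 0)
    (hP : ∀ p : ℕ, p.Prime → Odd p → ((G.Ed p N).ncard : ℚ) = P.eval (p : ℚ)) :
    (∃ H : QuasiPolynomial, IsCountingQuasiPolynomial G g N H ∧ H.HasLeadingCoeff c) ∧
      (∀ H : QuasiPolynomial, IsCountingQuasiPolynomial G g N H → ∀ t : ℤ, Odd t →
        H.coeff ((3 * g - 3) * N) t = c) := by
  have hd := QuasiPolynomial.hasDegree_ofPolynomial hdeg (by rwa [hc])
  refine ⟨⟨.ofPolynomial P, ⟨hd, fun _ => rfl, fun p hp hp2 => ?_⟩, _, hd, fun _ => hc⟩, ?_⟩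
  · rw [hP p hp hp2]
    simp [QuasiPolynomial.eval, QuasiPolynomial.ofPolynomial]
  · intro H hH t ht
    rw [QuasiPolynomial.coeff, QuasiPolynomial.constituent_eq_of_forall_prime hH.periodic
      (fun p hp hp2 => (hH.eval_eq p hp hp2).trans (hP p hp hp2)) ht, hc]

theorem proposition4p4 {V E : Type*} [Finite V] [Finite E] (G : BranchGraph V E) (g : ℕ)
    (hg : 1 < g) (hconn : G.IsConnected) (htri : G.IsTrivalent) (hgenus : G.bettiOne = g) :
    ((∃ H : QuasiPolynomial, IsCountingQuasiPolynomial G g 1 H ∧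
        H.HasLeadingCoeff
          ((-1) ^ g * bernoulli (2 * g - 2) / (2 * ((2 * g - 2).factorial : ℚ)))) ∧
      (∀ H : QuasiPolynomial, IsCountingQuasiPolynomial G g 1 H → ∀ t : ℤ, Odd t →
        H.coeff ((3 * g - 3) * 1) t =
          (-1) ^ g * bernoulli (2 * g - 2) / (2 * ((2 * g - 2).factorial : ℚ)))) ∧
    ((∃ H : QuasiPolynomial, IsCountingQuasiPolynomial G g 2 H ∧
        H.HasLeadingCoeff
          (2 ^ (3 * g - 5) * bernoulli (2 * g - 2) ^ 2 / ((2 * g - 2).factorial : ℚ) ^ 2)) ∧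
      (∀ H : QuasiPolynomial, IsCountingQuasiPolynomial G g 2 H → ∀ t : ℤ, Odd t →
        H.coeff ((3 * g - 3) * 2) t =
          2 ^ (3 * g - 5) * bernoulli (2 * g - 2) ^ 2 / ((2 * g - 2).factorial : ℚ) ^ 2)) := by
  obtain ⟨n, rfl⟩ : ∃ n, g = n + 1 := ⟨g - 1, by omega⟩
  have hn : n ≠ 0 := by omega
  obtain ⟨A, B, hA, hB, hAc, hBc, hodd, heven⟩ :=
    BranchGraph.exists_polynomial_ncard_balancedNumberings hn hconn htri hgenus
  have hb := bernoulli_two_mul_ne_zero hn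
  have hf : ((2 * n).factorial : ℚ) ≠ 0 := by exact_mod_cast (2 * n).factorial_ne_zero
  have h3 : 3 * (n + 1) - 3 = 3 * n := by omega
  rw [show 2 * (n + 1) - 2 = 2 * n by omega]
  constructor
  · refine exists_isCountingQuasiPolynomial (P := A) (by rwa [h3, mul_one])
      (by rw [h3, mul_one, hAc]) ?_ fun p _ hp => ?_
    · exact div_ne_zero (mul_ne_zero (pow_ne_zero _ (by norm_num)) hb)
        (mul_ne_zero two_ne_zero hf)
    · rw [G.Ed_one, hodd p hp]
  · have hB2 : (B.comp (Polynomial.C 2 * Polynomial.X)).natDegree ≤ 3 * n := by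
      refine Polynomial.natDegree_comp_le.trans ?_
      rw [Polynomial.natDegree_C_mul_X _ two_ne_zero, mul_one]
      exact hB
    refine exists_isCountingQuasiPolynomial
      (P := A * B.comp (Polynomial.C 2 * Polynomial.X)) ?_ ?_ ?_ fun p _ hp => ?_
    · rw [h3]
      exact Polynomial.natDegree_mul_le.trans (by omega)
    · rw [h3, mul_two, Polynomial.coeff_mul_add_eq_of_natDegree_le hA hB2,
        Polynomial.comp_C_mul_X_coeff, hBc, hAc]
      -- The factor 2^(3n) comes from substituting 2X in B; the 4 cancels the two denominators 2 of
      -- the coefficients of A and B.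
      have h5 : (2 : ℚ) ^ (3 * n) = 2 ^ (3 * (n + 1) - 5) * 4 := by
        rw [show 3 * n = (3 * (n + 1) - 5) + 2 by omega, pow_add]
        norm_num
      have h6 : ((-1 : ℚ) ^ (n + 1)) ^ 2 = 1 := by rw [← pow_mul, mul_comm, pow_mul]; norm_num
      rw [h5]
      field_simp
      rw [h6]
      ring
    · exact div_ne_zero (mul_ne_zero (pow_ne_zero _ two_ne_zero) (pow_ne_zero _ hb))
        (pow_ne_zero _ hf)
    · rw [BranchGraph.ncard_Ed_two htri hp, Nat.cast_mul, hodd p hp,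
        heven (2 * p) (even_two_mul p) (by have := hp.pos; omega)]
      simp
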